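/- Let $\mathbb T^2=\mathbb R^2/\mathbb Z^2$ be the flat torus, and let $u_0\in C^1(\mathbb T^2;\mathbb R^2)$ be nondegenerate, i.e. for some $\alpha_0>0$ $$|u_0(x)|+|\det\nabla u_0(x)|\ge\alpha_0\qquad\text{for all }x\in\mathbb T^2 .$$ For $\varepsilon>0$ let $u:[0,\infty)\times\mathbb T^2\to\mathbb R^2$ be a classical solution of the Ginzburg--Landau heat flow $$\partial_t u-\varepsilon^2\Delta u=(1-|u|^2)\,u\quad (t>0),\qquad u(0,\cdot)=u_0,$$ i.e. $u$ is continuous on $[0,\infty)\times\mathbb T^2$ and, for $t>0$, is $C^1$ in $t$ and $C^2$ in $x$ (the derivatives $\partial_tu,\nabla u,\nabla^2u$ being continuous on $(0,\infty)\times\mathbb T^2$). Let $\mathcal Z(t)=\{x\in\mathbb T^2: u(t,x)=0\}$ (so that $\mathcal Z(0)=\{u_0=0\}$). Then $\mathcal Z(0)$ is finite, $\mathcal Z(0)=\{z_1^0,\dots,z_N^0\}$ with distinct $z_j^0$ ($N\ge 0$), the topological degree $d_j$ of the vector field $u_0$ at $z_j^0$ is $1$ or $-1$, and there are constants $C_0>0$,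 $C>0$ and $\varepsilon_0>0$, depending only on $u_0$, such that for all $0<\varepsilon<\varepsilon_0$ and every such solution $u$, with $$T_\varepsilon=\ln\frac1\varepsilon-\frac12\ln\ln\frac1\varepsilon-C_0 ,$$ the following hold. 1. $\#\mathcal Z(t)=\#\mathcal Z(0)$ for all $0\le t\le T_\varepsilon$. 2. There are continuous paths $z_1,\dots,z_N:[0,T_\varepsilon]\to\mathbb T^2$ with $z_j(0)=z_j^0$ such that, for all $0\le t\le T_\varepsilon$, the points $z_1(t),\dots,z_N(t)$ are distinct, $\mathcal Z(t)=\{z_1(t),\dots,z_N(t)\}$, and for every $j$ $$|z_j(t)-z_j^0|\le C\,\varepsilon\sqrt{\ln(1/\varepsilon)}$$ (flat distance on $\mathbb T^2$), and the topological degree of the vector field $u(t,\cdot)$ at $z_j(t)$ is $d_j$. 3. $|u(T_\varepsilon,x)|\ge\frac12$ for every $x\in\mathbb T^2$ with $|x-z_j^0|\ge C\,\varepsilon\sqrt{\ln(1/\varepsilon)}$ for all $j$. -/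

import Mathlib

open Set

noncomputable section

namespace GinzburgLandau

/-- The Euclidean plane. -/
abbrev Plane : Type := EuclideanSpace ℝ (Fin 2)

/-- The integer lattice `ℤ²` in the plane. -/
def intLattice : AddSubgroup Plane where
  carrier := {x | ∀ i, ∃ n : ℤ, x i = n}
  zero_mem' := fun _ => ⟨0, by simp⟩
  add_mem' := by
    intro a b ha hb i
    obtain ⟨m, hm⟩ := ha i
    obtain ⟨n, hn⟩ := hb i
    exact ⟨m + n, by simp [hm, hn]⟩
  neg_mem' := by
    intro a ha i
    obtain ⟨m, hm⟩ := ha i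
    exact ⟨-m, by simp [hm]⟩

/-- The flat torus `ℝ² / ℤ²`. Its distance (Mathlib's metric on the quotient of a normed group) is
the flat one: the distance of two classes is the infimum of the Euclidean distances of their
representatives. -/
abbrev Torus : Type := Plane ⧸ intLattice

/-- A map on the torus, viewed as a `ℤ²`-periodic map on the plane. The differentiability of a map on
the torus, its gradient and its Laplacian are those of its lift. -/
def periodicLift (f : Torus → Plane) (x : Plane) : Plane := f (QuotientAddGroup.mk x)

/-- The set of zeros of a vector field on the torus. -/
def zeros (f : Torus → Plane) : Set Torus := {p | f p = 0}

/-- `u` is a (classical) solution, on `[0, ∞) × 𝕋²`, of the Ginzburg-Landau heat flow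
`∂ₜ u - ε² Δ u = (1 - |u|²) u` with initial datum `u₀`: it is continuous up to time `0`, where it
equals `u₀`, and for positive times it is `C¹` in time and `C²` in space, and satisfies the equation
pointwise. Only the values `u t` with `0 ≤ t` matter. -/
structure IsSolution (ε : ℝ) (u₀ : Torus → Plane) (u : ℝ → Torus → Plane) : Prop where
  initial : u 0 = u₀
  continuous : ContinuousOn (fun q : ℝ × Plane => periodicLift (u q.1) q.2) (Ici 0 ×ˢ univ)
  differentiable_time : ∀ t, 0 < t → ∀ x : Plane, DifferentiableAt ℝ (fun s => periodicLift (u s) x) t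
  contDiff_space : ∀ t, 0 < t → ContDiff ℝ 2 (periodicLift (u t))
  continuous_deriv : ContinuousOn (fun q : ℝ × Plane => deriv (fun s => periodicLift (u s) q.2) q.1)
    (Ioi 0 ×ˢ univ)
  continuous_grad : ContinuousOn (fun q : ℝ × Plane => fderiv ℝ (periodicLift (u q.1)) q.2)
    (Ioi 0 ×ˢ univ)
  continuous_hessian :
    ContinuousOn (fun q : ℝ × Plane => fderiv ℝ (fderiv ℝ (periodicLift (u q.1))) q.2) (Ioi 0 ×ˢ univ)
  equation : ∀ t, 0 < t → ∀ x : Plane,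
    deriv (fun s => periodicLift (u s) x) t - ε ^ 2 • Laplacian.laplacian (periodicLift (u t)) x
      = (1 - ‖periodicLift (u t) x‖ ^ 2) • periodicLift (u t) x

/-- The unit vector `(cos θ, sin θ)`. -/
def unitVec (θ : ℝ) : Plane := !₂[Real.cos θ, Real.sin θ]

/-- `z` is an isolated zero of the vector field `f` on the plane, and the topological degree (index)
of `f` at `z` is `d`: along every small circle around `z`, the argument of `f` has a continuous
determination `φ`, which increases by `2 π d` in one counterclockwise turn. -/
def HasDegreeAt (f : Plane → Plane) (z : Plane) (d : ℤ) : Prop :=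
  f z = 0 ∧ ∃ R : ℝ, 0 < R ∧ (∀ x, x ≠ z → ‖x - z‖ ≤ R → f x ≠ 0) ∧
    ∀ r : ℝ, 0 < r → r ≤ R → ∃ φ : ℝ → ℝ, ContinuousOn φ (Icc 0 (2 * Real.pi)) ∧
      (∀ θ ∈ Icc 0 (2 * Real.pi),
        f (z + r • unitVec θ) = ‖f (z + r • unitVec θ)‖ • unitVec (φ θ)) ∧
      φ (2 * Real.pi) - φ 0 = 2 * Real.pi * d

/-- The topological degree of the vector field `f` on the torus at its isolated zero `p` is `d`
(the lift of `f` has degree `d` at all representatives of `p`). -/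
def HasTorusDegreeAt (f : Torus → Plane) (p : Torus) (d : ℤ) : Prop :=
  ∀ x : Plane, (QuotientAddGroup.mk x : Torus) = p → HasDegreeAt (periodicLift f) x d

/-- The time `T = ln (1/ε) - (1/2) ln ln (1/ε) - C₀`. -/
def finalTime (C₀ ε : ℝ) : ℝ :=
  Real.log (1 / ε) - 1 / 2 * Real.log (Real.log (1 / ε)) - C₀

end GinzburgLandau

end

open GinzburgLandau

open Filter Topology Metric Laplacian InnerProductSpace

/-! ### A maximum principle with quadratic barriers -/

/-! Up to time `T_ε`, diffusion is only a perturbation of the ordinary differential equation `y' =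
(1 - |y|²) y`, solved at each point by `odeFlow`. The cubic term is monotone, so the difference of
two solutions, multiplied by `e⁻ᵗ`, stays below every supersolution of the heat equation that
dominates it initially. Quadratics `a + b (|x - z|² + 4ε²t)` suffice as barriers. Comparing `u` with
the flow of the constant datum `u₀(x)` gives `|u(t,x) - odeFlow t (u₀ x)| ≤ 2 L eᵗ l` with `l = ε
√(ln (1/ε))`, where `L` bounds `|∇u₀|`. The time `T_ε` is the one at which `eᵗ l` reaches the small
constant `σ = e^(-C₀)`.

A zero of `u(t,·)` therefore lies where `|u₀| ≤ 4 L l`. There nondegeneracy makes `∇u₀` invertible,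
and a quantitative inverse function theorem yields a zero of `u₀` within `R l`.

Conversely, near a zero `z` of `u₀`, the increments `e⁻ᵗ (u(t,x+h) - u(t,x))` stay close to `∇u₀(z)
h`, with relative error `m / 2`, where `m` bounds `∇u₀(z)` from below
(`norm_sub_sub_fderiv_le_scale`). This again comes from a barrier, applied to the difference of `u`
and its translate, so no gradient estimate for `u` is needed. The cubic term contributes an error of
order `(eᵗ l)² ≤ σ²`, which fixes `C₀`. From this one estimate follow the existence and uniqueness
of the zero near `z`, its continuity in time, and its degree, the sign of `det ∇u₀(z)`.

At the final time, a point at distance at least `C l` from the zeros has `eᵗ |u₀| ≥ 3`, so the flow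
has norm at least `3/4` there and `u` at least `1/2`. -/

theorem deriv_deriv_nonpos_of_isLocalMax {g : ℝ → ℝ} {s : ℝ} (hg : ContinuousAt g s)
    (h : IsLocalMax g s) : deriv (deriv g) s ≤ 0 := by
  by_contra hpos
  push Not at hpos
  -- A positive second derivative would make `s` a local minimum too, so `g` would be constant near
  -- `s`.
  have hmin : IsLocalMin g s := isLocalMin_of_deriv_deriv_pos hpos h.deriv_eq_zero hg
  have hconst : g =ᶠ[𝓝 s] fun _ => g s := by
    filter_upwards [h, hmin] with y hy hy' using le_antisymm hy hy'
  have h1 : deriv (deriv g) s = deriv (deriv fun _ : ℝ => g s) s := hconst.deriv.deriv_eq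
  simp at h1
  linarith

theorem fderiv_fderiv_nonpos_of_isLocalMax {E : Type*} [NormedAddCommGroup E] [NormedSpace ℝ E]
    {ψ : E → ℝ} {x : E} (hψ : ContDiff ℝ 2 ψ) (h : IsLocalMax ψ x) (e : E) :
    fderiv ℝ (fderiv ℝ ψ) x e e ≤ 0 := by
  have hline : ∀ s : ℝ, HasDerivAt (fun s : ℝ => x + s • e) e s := fun s => by
    simpa using ((hasDerivAt_id s).smul_const e).const_add x
  have hd : Differentiable ℝ ψ := hψ.differentiable (by norm_num)
  have hdd : Differentiable ℝ (fderiv ℝ ψ) :=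
    (hψ.fderiv_right (m := 1) (by norm_num)).differentiable (by norm_num)
  have h1 : deriv (fun s : ℝ => ψ (x + s • e)) = fun s => fderiv ℝ ψ (x + s • e) e := by
    funext s
    exact ((hd _).hasFDerivAt.comp_hasDerivAt s (hline s)).deriv
  have h2 : deriv (deriv (fun s : ℝ => ψ (x + s • e))) 0 = fderiv ℝ (fderiv ℝ ψ) x e e := by
    rw [h1]
    have h3 := (hdd (x + (0 : ℝ) • e)).hasFDerivAt.comp_hasDerivAt 0 (hline 0)
    have h4 := (ContinuousLinearMap.apply ℝ ℝ e).hasFDerivAt.comp_hasDerivAt 0 h3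
    exact h4.deriv.trans (by simp)
  rw [← h2]
  have hc : Continuous fun s : ℝ => x + s • e := by fun_prop
  refine deriv_deriv_nonpos_of_isLocalMax (hd.continuous.comp hc).continuousAt ?_
  have ht : Tendsto (fun s : ℝ => x + s • e) (𝓝 0) (𝓝 x) := by simpa using hc.tendsto 0
  filter_upwards [ht.eventually h] with s hs
  simpa using hs

theorem laplacian_nonpos_of_isLocalMax {E : Type*} [NormedAddCommGroup E] [InnerProductSpace ℝ E]
    [FiniteDimensional ℝ E] {ψ : E → ℝ} {x : E} (hψ : ContDiff ℝ 2 ψ) (h : IsLocalMax ψ x) :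
    Δ ψ x ≤ 0 := by
  rw [InnerProductSpace.laplacian_eq_iteratedFDeriv_stdOrthonormalBasis]
  refine Finset.sum_nonpos fun i _ => ?_
  rw [iteratedFDeriv_two_apply]
  exact fderiv_fderiv_nonpos_of_isLocalMax hψ h _

theorem laplacian_norm_sub_sq {E : Type*} [NormedAddCommGroup E] [InnerProductSpace ℝ E]
    [FiniteDimensional ℝ E] (z x : E) :
    Δ (fun y : E => ‖y - z‖ ^ 2) x = 2 * Module.finrank ℝ E := by
  obtain ⟨J, hJ⟩ : ∃ J : E →L[ℝ] E →L[ℝ] ℝ, ∀ a b, J a b = ⟪a, b⟫_ℝ := ⟨innerSL ℝ, fun _ _ => rfl⟩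
  have h1 : fderiv ℝ (fun y : E => ‖y - z‖ ^ 2) = fun y => (2 : ℝ) • J (y - z) := by
    funext y
    have h := (hasStrictFDerivAt_norm_sq (y - z)).hasFDerivAt.comp y
      ((hasFDerivAt_id y).sub_const z)
    refine (h.congr_fderiv ?_).fderiv
    ext w
    simp [hJ]
  have h2 : ∀ y, HasFDerivAt (fun y : E => (2 : ℝ) • J (y - z)) ((2 : ℝ) • J) y := fun y =>
    (J.hasFDerivAt.comp y ((hasFDerivAt_id y).sub_const z)).const_smul (2 : ℝ)
  rw [InnerProductSpace.laplacian_eq_iteratedFDeriv_stdOrthonormalBasis]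
  simp only [iteratedFDeriv_two_apply, h1, (h2 x).fderiv]
  simp [hJ, mul_comm]

/-- One-sided, because a maximum over `[0, T]` may be attained at `T`, where only earlier times are
available. -/
theorem deriv_nonneg_of_le_left {g : ℝ → ℝ} {g' t : ℝ} (ht : 0 < t) (hg : HasDerivAt g g' t)
    (h : ∀ s ∈ Ioo 0 t, g s ≤ g t) : 0 ≤ g' := by
  have h1 : Tendsto (slope g t) (𝓝[<] t) (𝓝 g') :=
    (hasDerivAt_iff_tendsto_slope.1 hg).mono_left
      (nhdsWithin_mono t fun s hs => ne_of_lt hs)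
  refine ge_of_tendsto h1 ?_
  filter_upwards [Ioo_mem_nhdsLT ht] with s hs
  rw [slope_def_field]
  exact div_nonneg_of_nonpos (by linarith [h s hs]) (by linarith [hs.2])

/-- The norm of a bounded vector field `V` stays below a quadratic barrier `α + β |x - z|²` if this
holds initially and if the barrier is a supersolution of the equation that `V` satisfies. -/
theorem norm_le_quadratic_barrier {ε T M : ℝ} {V V' : ℝ → Plane → Plane} {α β α' β' : ℝ → ℝ}
    {z : Plane}
    (hVc : ContinuousOn (fun q : ℝ × Plane => V q.1 q.2) (Icc 0 T ×ˢ univ))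
    (hM : ∀ t ∈ Icc 0 T, ∀ x, ‖V t x‖ ≤ M)
    (hVt : ∀ t ∈ Ioc 0 T, ∀ x, HasDerivAt (fun s => V s x) (V' t x) t)
    (hVx : ∀ t ∈ Ioc 0 T, ContDiff ℝ 2 (V t))
    (hα : ∀ t, HasDerivAt α (α' t) t) (hβ : ∀ t, HasDerivAt β (β' t) t)
    (hα0 : ∀ t ∈ Icc 0 T, 0 ≤ α t) (hβ0 : ∀ t ∈ Icc 0 T, 0 ≤ β t)
    (hinit : ∀ x, ‖V 0 x‖ ≤ α 0 + β 0 * ‖x - z‖ ^ 2)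
    (hineq : ∀ t ∈ Ioc 0 T, ∀ x, ⟪V' t x - ε ^ 2 • Δ (V t) x, V t x⟫_ℝ
      ≤ ‖V t x‖ * (α' t + β' t * ‖x - z‖ ^ 2 - 4 * ε ^ 2 * β t)) :
    ∀ t ∈ Icc 0 T, ∀ x, ‖V t x‖ ≤ α t + β t * ‖x - z‖ ^ 2 := by
  -- The term `η |x - z|²` confines the maximum to a compact set. The slope `(4ε² + 1) η` in time
  -- pays for its Laplacian with `η` to spare, so the supersolution is strict.
  suffices H : ∀ η > 0, ∀ t ∈ Icc 0 T, ∀ x, ‖V t x‖ ≤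
      (α t + η * (1 + (4 * ε ^ 2 + 1) * t)) + (β t + η) * ‖x - z‖ ^ 2 by
    intro t ht x
    have hlim : Tendsto (fun η : ℝ => (α t + η * (1 + (4 * ε ^ 2 + 1) * t))
        + (β t + η) * ‖x - z‖ ^ 2) (𝓝[>] 0) (𝓝 (α t + β t * ‖x - z‖ ^ 2)) := by
      have hc : Continuous (fun η : ℝ => (α t + η * (1 + (4 * ε ^ 2 + 1) * t))
        + (β t + η) * ‖x - z‖ ^ 2) := by fun_prop
      simpa using (hc.tendsto 0).mono_left nhdsWithin_le_nhds
    refine ge_of_tendsto hlim ?_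
    filter_upwards [self_mem_nhdsWithin] with η hη using H η hη t ht x
  intro η hη
  by_contra! hneg
  obtain ⟨t₁, ht₁, x₁, hx₁⟩ := hneg
  set b : ℝ → Plane → ℝ := fun t x =>
    (α t + η * (1 + (4 * ε ^ 2 + 1) * t)) + (β t + η) * ‖x - z‖ ^ 2 with hb
  have hT : 0 ≤ T := ht₁.1.trans ht₁.2
  have hαc : Continuous α := continuous_iff_continuousAt.2 fun t => (hα t).continuousAt
  have hβc : Continuous β := continuous_iff_continuousAt.2 fun t => (hβ t).continuousAt
  have hbc : Continuous fun q : ℝ × Plane => b q.1 q.2 := by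
    simp only [hb]; fun_prop
  have hM0 : 0 ≤ M := (norm_nonneg _).trans (hM t₁ ht₁ x₁)
  obtain ⟨ρ, hρ0, hρ⟩ : ∃ ρ : ℝ, 0 ≤ ρ ∧ M ≤ η * ρ ^ 2 :=
    ⟨√(M / η), Real.sqrt_nonneg _, by
      rw [Real.sq_sqrt (by positivity)]; field_simp; exact le_rfl⟩
  have hout : ∀ t ∈ Icc 0 T, ∀ x, ρ ≤ ‖x - z‖ → ‖V t x‖ < b t x := by
    intro t ht x hx
    have h1 : η * ρ ^ 2 ≤ η * ‖x - z‖ ^ 2 := by gcongr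
    have h2 : 0 ≤ β t * ‖x - z‖ ^ 2 := mul_nonneg (hβ0 t ht) (sq_nonneg _)
    have h3 : 0 ≤ η * ((4 * ε ^ 2 + 1) * t) := by have := ht.1; positivity
    have := hα0 t ht
    have := hM t ht x
    have hbe : b t x = α t + β t * ‖x - z‖ ^ 2 + η + η * ((4 * ε ^ 2 + 1) * t)
      + η * ‖x - z‖ ^ 2 := by simp only [hb]; ring
    linarith
  have hx₁in : ‖x₁ - z‖ ≤ ρ := by
    by_contra! hcon
    exact absurd (hout t₁ ht₁ x₁ hcon.le) (by simpa [hb] using hx₁.le)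
  have hK : IsCompact (Icc 0 T ×ˢ closedBall z ρ : Set (ℝ × Plane)) :=
    isCompact_Icc.prod (isCompact_closedBall z ρ)
  have hcont : ContinuousOn (fun q : ℝ × Plane => ‖V q.1 q.2‖ - b q.1 q.2)
      (Icc 0 T ×ˢ closedBall z ρ) :=
    ((hVc.mono (prod_mono_right (subset_univ _))).norm).sub hbc.continuousOn
  obtain ⟨⟨t₀, x₀⟩, ⟨ht₀, hx₀⟩, hmax⟩ := hK.exists_isMaxOn
    ⟨(t₁, x₁), ht₁, mem_closedBall_iff_norm.2 hx₁in⟩ hcont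
  change t₀ ∈ Icc 0 T at ht₀
  change x₀ ∈ closedBall z ρ at hx₀
  have hmem : ∀ {t x}, t ∈ Icc 0 T → ‖x - z‖ ≤ ρ → (t, x) ∈ (Icc 0 T ×ˢ closedBall z ρ) :=
    fun ht hx => ⟨ht, mem_closedBall_iff_norm.2 hx⟩
  have hmax' : ∀ t ∈ Icc 0 T, ∀ x, ‖x - z‖ ≤ ρ → ‖V t x‖ - b t x ≤ ‖V t₀ x₀‖ - b t₀ x₀ :=
    fun t ht x hx => isMaxOn_iff.1 hmax (t, x) (hmem ht hx)
  have hge : ∀ t ∈ Icc 0 T, ∀ x, ‖V t x‖ - b t x ≤ ‖V t₀ x₀‖ - b t₀ x₀ := by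
    intro t ht x
    rcases le_total ‖x - z‖ ρ with h | h
    · exact hmax' t ht x h
    · have h1 := hout t ht x h
      have h2 : ‖V t₁ x₁‖ - b t₁ x₁ ≤ ‖V t₀ x₀‖ - b t₀ x₀ :=
        hmax' t₁ ht₁ x₁ hx₁in
      have h3 : b t₁ x₁ < ‖V t₁ x₁‖ := hx₁
      linarith
  have hpos : b t₀ x₀ < ‖V t₀ x₀‖ := by
    have h2 := hge t₁ ht₁ x₁
    have h3 : b t₁ x₁ < ‖V t₁ x₁‖ := hx₁
    linarith
  have hb0 : 0 < b t₀ x₀ := by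
    have := hα0 t₀ ht₀
    have h2 : 0 ≤ β t₀ * ‖x₀ - z‖ ^ 2 := mul_nonneg (hβ0 t₀ ht₀) (sq_nonneg _)
    have h3 : 0 < η * (1 + (4 * ε ^ 2 + 1) * t₀) := by have := ht₀.1; positivity
    have h4 : 0 ≤ η * ‖x₀ - z‖ ^ 2 := by positivity
    have hbe : b t₀ x₀ = α t₀ + β t₀ * ‖x₀ - z‖ ^ 2 + η * (1 + (4 * ε ^ 2 + 1) * t₀)
      + η * ‖x₀ - z‖ ^ 2 := by simp only [hb]; ring
    linarith
  have hv : 0 < ‖V t₀ x₀‖ := hb0.trans hpos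
  have ht₀pos : 0 < t₀ := by
    rcases ht₀.1.eq_or_lt with h | h
    · exfalso
      have h1 := hinit x₀
      rw [← h] at hpos
      have h4 : 0 ≤ η * ‖x₀ - z‖ ^ 2 := by positivity
      have hbe : b 0 x₀ = α 0 + β 0 * ‖x₀ - z‖ ^ 2 + η + η * ‖x₀ - z‖ ^ 2 := by
        simp only [hb]; ring
      linarith
    · exact h
  have ht₀' : t₀ ∈ Ioc 0 T := ⟨ht₀pos, ht₀.2⟩
  set v : Plane := V t₀ x₀ with hvdef
  -- the scalar function `⟪V, v⟫ - |v| b` also has its maximum at `(t₀, x₀)`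
  have hscal : ∀ t ∈ Icc 0 T, ∀ x, ⟪v, V t x⟫_ℝ - ‖v‖ * b t x ≤ ⟪v, v⟫_ℝ - ‖v‖ * b t₀ x₀ := by
    intro t ht x
    have h1 := real_inner_le_norm v (V t x)
    have h2 : ‖v‖ * (‖V t x‖ - b t x) ≤ ‖v‖ * (‖v‖ - b t₀ x₀) :=
      mul_le_mul_of_nonneg_left (hge t ht x) hv.le
    rw [real_inner_self_eq_norm_sq]
    linarith
  have hbt : HasDerivAt (fun t => b t x₀)
      (α' t₀ + η * (4 * ε ^ 2 + 1) + β' t₀ * ‖x₀ - z‖ ^ 2) t₀ := by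
    have h1 : HasDerivAt (fun t : ℝ => η * (1 + (4 * ε ^ 2 + 1) * t)) (η * (4 * ε ^ 2 + 1)) t₀ := by
      simpa using (((hasDerivAt_id t₀).const_mul (4 * ε ^ 2 + 1)).const_add 1).const_mul η
    exact ((hα t₀).add h1).add (((hβ t₀).add_const η).mul_const (‖x₀ - z‖ ^ 2))
  have htime : 0 ≤ ⟪v, V' t₀ x₀⟫_ℝ
      - ‖v‖ * (α' t₀ + η * (4 * ε ^ 2 + 1) + β' t₀ * ‖x₀ - z‖ ^ 2) := by
    have h1 : HasDerivAt (fun t => ⟪v, V t x₀⟫_ℝ - ‖v‖ * b t x₀) _ t₀ :=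
      (((innerSL ℝ v).hasFDerivAt.comp_hasDerivAt t₀ (hVt t₀ ht₀' x₀))).sub (hbt.const_mul ‖v‖)
    refine deriv_nonneg_of_le_left ht₀pos h1 fun s hs => ?_
    exact hscal s ⟨hs.1.le, hs.2.le.trans ht₀.2⟩ x₀
  have hq : ContDiff ℝ 2 fun x : Plane => ‖x - z‖ ^ 2 :=
    (contDiff_id.sub contDiff_const).norm_sq ℝ
  have hbx : ContDiff ℝ 2 (b t₀) := by
    simp only [hb]; exact contDiff_const.add (contDiff_const.mul hq)
  have hΔb : Δ (b t₀) x₀ = 4 * (β t₀ + η) := by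
    have h1 : b t₀ = (fun _ => (α t₀ + η * (1 + (4 * ε ^ 2 + 1) * t₀)))
        + (β t₀ + η) • fun x : Plane => ‖x - z‖ ^ 2 := by
      funext x; simp [hb]
    have h2 : ContDiff ℝ 2 ((β t₀ + η) • fun x : Plane => ‖x - z‖ ^ 2) := contDiff_const.smul hq
    rw [h1, ContDiffAt.laplacian_add contDiffAt_const h2.contDiffAt,
      InnerProductSpace.laplacian_smul _ hq.contDiffAt, laplacian_norm_sub_sq]
    simp; ring
  have hVx₀ := hVx t₀ ht₀'
  have hspace : ⟪v, Δ (V t₀) x₀⟫_ℝ - ‖v‖ * (4 * (β t₀ + η)) ≤ 0 := by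
    have h1 : ContDiff ℝ 2 ((innerSL ℝ v) ∘ V t₀) := (innerSL ℝ v).contDiff.comp hVx₀
    have h3 : ContDiff ℝ 2 (‖v‖ • b t₀) := contDiff_const.smul hbx
    have h2 : Δ ((innerSL ℝ v) ∘ V t₀ - ‖v‖ • b t₀) x₀
        = ⟪v, Δ (V t₀) x₀⟫_ℝ - ‖v‖ * (4 * (β t₀ + η)) := by
      rw [ContDiffAt.laplacian_sub h1.contDiffAt h3.contDiffAt,
        InnerProductSpace.laplacian_smul _ hbx.contDiffAt, hΔb,
        ContDiffAt.laplacian_CLM_comp_left hVx₀.contDiffAt]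
      simp
    rw [← h2]
    refine laplacian_nonpos_of_isLocalMax (h1.sub h3) ?_
    exact Filter.Eventually.of_forall fun x => hscal t₀ ht₀ x
  -- The time and space inequalities at the maximum force the left side of `hineq` to exceed its
  -- right side by at least `‖v‖ η`.
  have hfin := hineq t₀ ht₀' x₀
  rw [← hvdef, real_inner_comm, inner_sub_right, inner_smul_right] at hfin
  have h5 := mul_le_mul_of_nonneg_left hspace (sq_nonneg ε)
  have h6 := mul_pos hv hη
  nlinarith only [h5, h6, hfin, htime]

/-! ### Comparison of bounded solutions on the plane -/

/-- The cubic nonlinearity `|a|² a`. -/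
noncomputable def cubic (a : Plane) : Plane := ‖a‖ ^ 2 • a

/-- The cubic is the gradient of the convex function `|a|⁴ / 4`. Explicitly, the inner product is at
least `(|a|² - |b|²)² / 2`. -/
theorem inner_cubic_sub_nonneg (a b : Plane) : 0 ≤ ⟪cubic a - cubic b, a - b⟫_ℝ := by
  have h1 : ⟪cubic a - cubic b, a - b⟫_ℝ
      = ‖a‖ ^ 2 * ‖a‖ ^ 2 + ‖b‖ ^ 2 * ‖b‖ ^ 2 - (‖a‖ ^ 2 + ‖b‖ ^ 2) * ⟪a, b⟫_ℝ := by
    simp only [cubic, inner_sub_left, inner_sub_right, real_inner_smul_left,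
      real_inner_self_eq_norm_sq, real_inner_comm a b]
    ring
  have h2 : ⟪a, b⟫_ℝ ≤ (‖a‖ ^ 2 + ‖b‖ ^ 2) / 2 := by
    have := real_inner_le_norm a b
    nlinarith [sq_nonneg (‖a‖ - ‖b‖)]
  have h3 := mul_le_mul_of_nonneg_left h2 (by positivity : 0 ≤ ‖a‖ ^ 2 + ‖b‖ ^ 2)
  rw [h1]
  nlinarith [sq_nonneg (‖a‖ ^ 2 - ‖b‖ ^ 2)]

theorem norm_cubic_sub_le (a b : Plane) :
    ‖cubic a - cubic b‖ ≤ 3 / 2 * (‖a‖ ^ 2 + ‖b‖ ^ 2) * ‖a - b‖ := by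
  have h1 : cubic a - cubic b = ‖a‖ ^ 2 • (a - b) + ((‖a‖ - ‖b‖) * (‖a‖ + ‖b‖)) • b := by
    simp only [cubic]; module
  have h2 : |‖a‖ - ‖b‖| ≤ ‖a - b‖ := abs_norm_sub_norm_le a b
  calc ‖cubic a - cubic b‖ ≤ ‖a‖ ^ 2 * ‖a - b‖ + |‖a‖ - ‖b‖| * (‖a‖ + ‖b‖) * ‖b‖ := by
        rw [h1]
        refine (norm_add_le _ _).trans_eq ?_
        rw [norm_smul, norm_smul, Real.norm_eq_abs, Real.norm_eq_abs, abs_mul,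
          abs_of_nonneg (by positivity : 0 ≤ ‖a‖ ^ 2),
          abs_of_nonneg (by positivity : 0 ≤ ‖a‖ + ‖b‖)]
    _ ≤ ‖a‖ ^ 2 * ‖a - b‖ + ‖a - b‖ * (‖a‖ + ‖b‖) * ‖b‖ := by gcongr
    _ = (‖a‖ ^ 2 + ‖a‖ * ‖b‖ + ‖b‖ ^ 2) * ‖a - b‖ := by ring
    _ ≤ 3 / 2 * (‖a‖ ^ 2 + ‖b‖ ^ 2) * ‖a - b‖ := by
        gcongr
        nlinarith [sq_nonneg (‖a‖ - ‖b‖)]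

/-- A bounded classical solution on `[0, T] × ℝ²` of the Ginzburg-Landau heat flow. -/
structure IsPlaneSolution (ε T : ℝ) (U : ℝ → Plane → Plane) : Prop where
  continuousOn : ContinuousOn (fun q : ℝ × Plane => U q.1 q.2) (Icc 0 T ×ˢ univ)
  bounded : ∃ M, ∀ t ∈ Icc 0 T, ∀ x, ‖U t x‖ ≤ M
  contDiff : ∀ t ∈ Ioc 0 T, ContDiff ℝ 2 (U t)
  hasDerivAt : ∀ t ∈ Ioc 0 T, ∀ x,
    HasDerivAt (fun s => U s x) (ε ^ 2 • Δ (U t) x + (U t x - cubic (U t x))) t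

theorem laplacian_comp_add_right (f : Plane → Plane) (h x : Plane) :
    Δ (fun y => f (y + h)) x = Δ f (x + h) := by
  simp only [InnerProductSpace.laplacian_eq_iteratedFDeriv_stdOrthonormalBasis]
  simp only [iteratedFDeriv_comp_add_right]

theorem IsPlaneSolution.translate {ε T : ℝ} {U : ℝ → Plane → Plane} (hU : IsPlaneSolution ε T U)
    (h : Plane) : IsPlaneSolution ε T fun t x => U t (x + h) where
  continuousOn := by
    have hc : Continuous fun q : ℝ × Plane => (q.1, q.2 + h) := by fun_prop
    exact hU.continuousOn.comp hc.continuousOn fun q hq => ⟨hq.1, mem_univ _⟩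
  bounded := by
    obtain ⟨M, hM⟩ := hU.bounded
    exact ⟨M, fun t ht x => hM t ht _⟩
  contDiff t ht := (hU.contDiff t ht).comp (contDiff_id.add contDiff_const)
  hasDerivAt t ht x := by
    rw [laplacian_comp_add_right]
    exact hU.hasDerivAt t ht (x + h)

/-- A quadratic barrier for the rescaled difference of two solutions. -/
theorem IsPlaneSolution.norm_exp_smul_sub_le {ε T : ℝ} {U W : ℝ → Plane → Plane}
    (hU : IsPlaneSolution ε T U) (hW : IsPlaneSolution ε T W)
    {α β α' β' : ℝ → ℝ} {z k : Plane}
    (hα : ∀ t, HasDerivAt α (α' t) t) (hβ : ∀ t, HasDerivAt β (β' t) t)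
    (hα0 : ∀ t ∈ Icc 0 T, 0 ≤ α t) (hβ0 : ∀ t ∈ Icc 0 T, 0 ≤ β t)
    (hinit : ∀ x, ‖U 0 x - W 0 x - k‖ ≤ α 0 + β 0 * ‖x - z‖ ^ 2)
    (hineq : ∀ t ∈ Ioc 0 T, ∀ x,
      -⟪cubic (U t x) - cubic (W t x), Real.exp (-t) • (U t x - W t x) - k⟫_ℝ
        ≤ Real.exp t * (‖Real.exp (-t) • (U t x - W t x) - k‖ *
          (α' t + β' t * ‖x - z‖ ^ 2 - 4 * ε ^ 2 * β t))) :
    ∀ t ∈ Icc 0 T, ∀ x,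
      ‖Real.exp (-t) • (U t x - W t x) - k‖ ≤ α t + β t * ‖x - z‖ ^ 2 := by
  obtain ⟨M₁, hM₁⟩ := hU.bounded
  obtain ⟨M₂, hM₂⟩ := hW.bounded
  have hexp : ∀ t, HasDerivAt (fun s : ℝ => Real.exp (-s)) (-Real.exp (-t)) t := fun t => by
    simpa using (hasDerivAt_neg t).exp
  refine norm_le_quadratic_barrier (ε := ε) (M := M₁ + M₂ + ‖k‖)
    (V := fun t x => Real.exp (-t) • (U t x - W t x) - k)
    (V' := fun t x => Real.exp (-t) • ((ε ^ 2 • Δ (U t) x + (U t x - cubic (U t x)))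
      - (ε ^ 2 • Δ (W t) x + (W t x - cubic (W t x))))
      + (-Real.exp (-t)) • (U t x - W t x)) (α' := α') (β' := β') ?_ ?_ ?_ ?_ hα hβ hα0 hβ0 ?_ ?_
  · have hc : Continuous fun q : ℝ × Plane => Real.exp (-q.1) := by fun_prop
    exact (hc.continuousOn.smul (hU.continuousOn.sub hW.continuousOn)).sub continuousOn_const
  · intro t ht x
    have h1 : Real.exp (-t) ≤ 1 := Real.exp_le_one_iff.2 (by linarith [ht.1])
    have h2 : ‖Real.exp (-t) • (U t x - W t x)‖ ≤ 1 * (M₁ + M₂) := by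
      rw [norm_smul, Real.norm_eq_abs, Real.abs_exp]
      gcongr
      exact (norm_sub_le _ _).trans (add_le_add (hM₁ t ht x) (hM₂ t ht x))
    exact (norm_sub_le _ _).trans (by linarith)
  · intro t ht x
    have h1 := (hU.hasDerivAt t ht x).sub (hW.hasDerivAt t ht x)
    have h2 := (hexp t).fun_smul h1
    exact h2.sub_const k
  · intro t ht
    have h1 : ContDiff ℝ 2 fun _ : Plane => Real.exp (-t) := contDiff_const
    exact (h1.smul ((hU.contDiff t ht).sub (hW.contDiff t ht))).sub contDiff_const
  · intro x; simpa using hinit x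
  · intro t ht x
    have hcU := hU.contDiff t ht
    have hcW := hW.contDiff t ht
    have h1 : ContDiff ℝ 2 (U t - W t) := hcU.sub hcW
    have h2 : ContDiff ℝ 2 (Real.exp (-t) • (U t - W t)) := contDiff_const.smul h1
    have hΔ : Δ (fun x => Real.exp (-t) • (U t x - W t x) - k) x
        = Real.exp (-t) • (Δ (U t) x - Δ (W t) x) := by
      have h3 : (fun x => Real.exp (-t) • (U t x - W t x) - k)
          = Real.exp (-t) • (U t - W t) - fun _ => k := rfl
      rw [h3, ContDiffAt.laplacian_sub h2.contDiffAt contDiffAt_const,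
        InnerProductSpace.laplacian_smul _ h1.contDiffAt,
        ContDiffAt.laplacian_sub hcU.contDiffAt hcW.contDiffAt]
      simp
    -- The factor `e⁻ᵗ` cancels the linear growth term and the constant `k` has no derivatives, so
    -- only the cubic difference remains.
    have h4 : (Real.exp (-t) • ((ε ^ 2 • Δ (U t) x + (U t x - cubic (U t x)))
      - (ε ^ 2 • Δ (W t) x + (W t x - cubic (W t x))))
      + (-Real.exp (-t)) • (U t x - W t x))
      - ε ^ 2 • (Real.exp (-t) • (Δ (U t) x - Δ (W t) x))
      = -(Real.exp (-t) • (cubic (U t x) - cubic (W t x))) := by module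
    rw [hΔ, h4, inner_neg_left, real_inner_smul_left]
    have h5 := mul_le_mul_of_nonneg_left (hineq t ht x) (Real.exp_pos (-t)).le
    rw [← mul_assoc, ← Real.exp_add, neg_add_cancel, Real.exp_zero, one_mul] at h5
    linarith

/-- By monotonicity the cubic term has the favourable sign, and `a + b (|x - z|² + 4ε²t)` is an
exact solution of the heat equation in dimension two. -/
theorem IsPlaneSolution.norm_sub_le {ε T a b : ℝ} {U W : ℝ → Plane → Plane} {z : Plane}
    (hU : IsPlaneSolution ε T U) (hW : IsPlaneSolution ε T W) (ha : 0 ≤ a) (hb : 0 ≤ b)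
    (hinit : ∀ x, ‖U 0 x - W 0 x‖ ≤ a + b * ‖x - z‖ ^ 2) {t : ℝ} (ht : t ∈ Icc 0 T) (x : Plane) :
    ‖U t x - W t x‖ ≤ Real.exp t * (a + b * (‖x - z‖ ^ 2 + 4 * ε ^ 2 * t)) := by
  have h := hU.norm_exp_smul_sub_le hW (k := 0) (z := z) (α := fun t => a + b * (4 * ε ^ 2 * t))
    (β := fun _ => b) (α' := fun _ => b * (4 * ε ^ 2)) (β' := fun _ => 0) ?_ ?_ ?_ ?_ ?_ ?_ t ht x
  · rw [sub_zero, norm_smul, Real.norm_eq_abs, Real.abs_exp] at h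
    have h2 := mul_le_mul_of_nonneg_left h (Real.exp_pos t).le
    rw [← mul_assoc, ← Real.exp_add, add_neg_cancel, Real.exp_zero, one_mul] at h2
    refine h2.trans_eq ?_
    ring
  · intro t
    simpa using (((hasDerivAt_id t).const_mul (4 * ε ^ 2)).const_mul b).const_add a
  · intro t; exact hasDerivAt_const t b
  · intro t ht; have := ht.1; positivity
  · intro t ht; exact hb
  · intro x; simpa using hinit x
  · intro t ht x
    have h1 := inner_cubic_sub_nonneg (U t x) (W t x)
    rw [sub_zero, real_inner_smul_right]
    have h3 : b * (4 * ε ^ 2) + 0 * ‖x - z‖ ^ 2 - 4 * ε ^ 2 * b = 0 := by ring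
    rw [h3, mul_zero, mul_zero]
    have := mul_nonneg (Real.exp_pos (-t)).le h1
    linarith

/-- The cone `L |x - z|` is the lower envelope of the paraboloids `L μ / 2 + L |x - z|² / (2 μ)`.
Each of them is a barrier, and the best `μ` at `(t, x)` is `√S`. -/
theorem IsPlaneSolution.norm_sub_le_sqrt {ε T L : ℝ} {U W : ℝ → Plane → Plane} {z : Plane}
    (hU : IsPlaneSolution ε T U) (hW : IsPlaneSolution ε T W) (hL : 0 ≤ L)
    (hinit : ∀ x, ‖U 0 x - W 0 x‖ ≤ L * ‖x - z‖) {t : ℝ} (ht : t ∈ Icc 0 T) (x : Plane) :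
    ‖U t x - W t x‖ ≤ Real.exp t * (L * √(‖x - z‖ ^ 2 + 4 * ε ^ 2 * t)) := by
  set S := ‖x - z‖ ^ 2 + 4 * ε ^ 2 * t with hS
  have hS0 : 0 ≤ S := by have := ht.1; positivity
  have key : ∀ μ > 0, S ≤ μ ^ 2 → ‖U t x - W t x‖ ≤ Real.exp t * (L * μ) := by
    intro μ hμ hSμ
    have h1 := hU.norm_sub_le hW (a := L * μ / 2) (b := L / (2 * μ)) (z := z) (by positivity)
      (by positivity) (fun y => (hinit y).trans ?_) ht x
    · refine h1.trans ?_
      gcongr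
      rw [← hS]
      calc L * μ / 2 + L / (2 * μ) * S ≤ L * μ / 2 + L / (2 * μ) * μ ^ 2 := by gcongr
        _ = L * μ := by field_simp; ring
    · have h2 : L * μ / 2 + L / (2 * μ) * ‖y - z‖ ^ 2 - L * ‖y - z‖
          = L / (2 * μ) * (μ - ‖y - z‖) ^ 2 := by field_simp; ring
      have : 0 ≤ L / (2 * μ) * (μ - ‖y - z‖) ^ 2 := by positivity
      linarith
  have hlim : Tendsto (fun μ : ℝ => Real.exp t * (L * (√S + μ))) (𝓝[>] 0)
      (𝓝 (Real.exp t * (L * √S))) := by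
    have hc : Continuous fun μ : ℝ => Real.exp t * (L * (√S + μ)) := by fun_prop
    simpa using (hc.tendsto 0).mono_left nhdsWithin_le_nhds
  -- `S` may vanish while `μ` must be positive, hence the limit of `√S + μ`.
  refine ge_of_tendsto hlim ?_
  filter_upwards [self_mem_nhdsWithin] with μ hμ
  have hμ : 0 < μ := hμ
  refine key _ (by positivity) ?_
  nlinarith [Real.sq_sqrt hS0, Real.sqrt_nonneg S]

/-! ### The pointwise ordinary differential equation -/

/-- The solution of the ordinary differential equation `y' = (1 - |y|²) y` with `y 0 = w`. -/
noncomputable def odeFlow (t : ℝ) (w : Plane) : Plane :=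
  (Real.exp t / √(1 + (Real.exp (2 * t) - 1) * ‖w‖ ^ 2)) • w

theorem odeFlow_zero (w : Plane) : odeFlow 0 w = w := by simp [odeFlow]

theorem odeFlow_zero_right (t : ℝ) : odeFlow t 0 = 0 := by simp [odeFlow]

theorem one_le_odeFlow_radicand {t : ℝ} (ht : 0 ≤ t) (w : Plane) :
    1 ≤ 1 + (Real.exp (2 * t) - 1) * ‖w‖ ^ 2 := by
  have : 1 ≤ Real.exp (2 * t) := Real.one_le_exp (by linarith)
  nlinarith [mul_nonneg (sub_nonneg.2 this) (sq_nonneg ‖w‖)]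

theorem hasDerivAt_odeFlow {t : ℝ} (ht : 0 ≤ t) (w : Plane) :
    HasDerivAt (fun s => odeFlow s w) (odeFlow t w - cubic (odeFlow t w)) t := by
  set q := 1 + (Real.exp (2 * t) - 1) * ‖w‖ ^ 2 with hq
  have hq1 : 1 ≤ q := one_le_odeFlow_radicand ht w
  have hq0 : 0 < q := by linarith
  have hs : 0 < √q := Real.sqrt_pos.2 hq0
  have h1 : HasDerivAt (fun s : ℝ => 1 + (Real.exp (2 * s) - 1) * ‖w‖ ^ 2)
      (2 * Real.exp (2 * t) * ‖w‖ ^ 2) t := by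
    have h2 : HasDerivAt (fun s : ℝ => Real.exp (2 * s)) (2 * Real.exp (2 * t)) t := by
      simpa [mul_comm] using ((hasDerivAt_id t).const_mul 2).exp
    exact ((h2.sub_const 1).mul_const _).const_add 1
  have h3 := ((Real.hasDerivAt_exp t).div (h1.sqrt hq0.ne') hs.ne').smul_const w
  refine h3.congr_deriv ?_
  have h4 : odeFlow t w = (Real.exp t / √q) • w := rfl
  rw [h4]
  simp only [cubic, norm_smul, Real.norm_eq_abs, abs_of_pos (div_pos (Real.exp_pos t) hs),
    ← hq, smul_smul, ← sub_smul]
  congr 1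
  have h5 : Real.exp (2 * t) = Real.exp t ^ 2 := by rw [← Real.exp_nat_mul]; norm_num
  rw [h5]
  field_simp

theorem isPlaneSolution_odeFlow (ε T : ℝ) (w : Plane) :
    IsPlaneSolution ε T fun t _ => odeFlow t w where
  continuousOn := by
    have h : ContinuousOn (fun t => odeFlow t w) (Icc 0 T) := fun t ht =>
      (hasDerivAt_odeFlow ht.1 w).continuousAt.continuousWithinAt
    exact h.comp continuousOn_fst fun q hq => hq.1
  bounded := by
    have h : ContinuousOn (fun t => odeFlow t w) (Icc 0 T) := fun t ht =>
      (hasDerivAt_odeFlow ht.1 w).continuousAt.continuousWithinAt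
    obtain ⟨M, hM⟩ := isCompact_Icc.exists_bound_of_continuousOn h
    exact ⟨M, fun t ht _ => hM t ht⟩
  contDiff _ _ := contDiff_const
  hasDerivAt t ht x := by
    simpa using hasDerivAt_odeFlow ht.1.le w

theorem norm_odeFlow {t : ℝ} (ht : 0 ≤ t) (w : Plane) :
    ‖odeFlow t w‖ ^ 2 * (1 + (Real.exp (2 * t) - 1) * ‖w‖ ^ 2) = Real.exp (2 * t) * ‖w‖ ^ 2 := by
  have hq1 := one_le_odeFlow_radicand ht w
  rw [odeFlow, norm_smul, mul_pow, Real.norm_eq_abs, sq_abs, div_pow, Real.sq_sqrt (by linarith)]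
  have h5 : Real.exp (2 * t) = Real.exp t ^ 2 := by rw [← Real.exp_nat_mul]; norm_num
  have : 1 + (Real.exp (2 * t) - 1) * ‖w‖ ^ 2 ≠ 0 := by linarith
  rw [div_mul_eq_mul_div, div_mul_cancel₀ _ this, h5]

/-- If the flow is small at time `t`, its initial value is at most of the order `e⁻ᵗ`. -/
theorem exp_mul_norm_le_of_norm_odeFlow_le {t η : ℝ} (ht : 0 ≤ t) {w : Plane}
    (hη : η ≤ 1 / 2) (h : ‖odeFlow t w‖ ≤ η) : Real.exp t * ‖w‖ ≤ 2 * η := by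
  have h1 := norm_odeFlow ht w
  have h5 : Real.exp (2 * t) = Real.exp t ^ 2 := by rw [← Real.exp_nat_mul]; norm_num
  have hη0 : 0 ≤ η := (norm_nonneg _).trans h
  have h2 : ‖odeFlow t w‖ ^ 2 ≤ η ^ 2 := by gcongr
  have hq1 := one_le_odeFlow_radicand ht w
  have h3 := mul_le_mul_of_nonneg_right h2 (by linarith : 0 ≤ 1 + (Real.exp (2 * t) - 1) * ‖w‖ ^ 2)
  rw [h1, h5] at h3
  set A := Real.exp t * ‖w‖ with hA
  have hA0 : 0 ≤ A := by positivity
  have h4 : A ^ 2 ≤ η ^ 2 * (1 + A ^ 2) := by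
    have : 0 ≤ η ^ 2 * ‖w‖ ^ 2 := by positivity
    rw [hA, mul_pow]; nlinarith
  have h6 : η ^ 2 * A ^ 2 ≤ 1 / 4 * A ^ 2 := by
    gcongr; nlinarith
  refine abs_le_of_sq_le_sq' (by nlinarith) (by linarith) |>.2

/-- With `A = eᵗ |w|`, the squared norm of the flow is at least `A² / (1 + A²) ≥ 9/10`, which
exceeds `(3/4)²`. -/
theorem three_quarters_le_norm_odeFlow {t : ℝ} (ht : 0 ≤ t) {w : Plane}
    (h : 3 ≤ Real.exp t * ‖w‖) : 3 / 4 ≤ ‖odeFlow t w‖ := by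
  have h1 := norm_odeFlow ht w
  have h5 : Real.exp (2 * t) = Real.exp t ^ 2 := by rw [← Real.exp_nat_mul]; norm_num
  rw [h5] at h1
  by_contra! hlt
  have h2 : ‖odeFlow t w‖ ^ 2 ≤ (3 / 4) ^ 2 := by gcongr
  have hq1 := one_le_odeFlow_radicand ht w
  rw [h5] at hq1
  have h3 := mul_le_mul_of_nonneg_right h2 (by linarith : 0 ≤ 1 + (Real.exp t ^ 2 - 1) * ‖w‖ ^ 2)
  have h4 : 9 ≤ Real.exp t ^ 2 * ‖w‖ ^ 2 := by
    rw [← mul_pow]; nlinarith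
  nlinarith [sq_nonneg ‖w‖]

/-! ### Comparison with the pointwise flow and with the linearization -/

theorem exp_neg_mul_le {t a b : ℝ} (h : a ≤ Real.exp t * b) : Real.exp (-t) * a ≤ b := by
  have := mul_le_mul_of_nonneg_left h (Real.exp_pos (-t)).le
  rwa [← mul_assoc, ← Real.exp_add, neg_add_cancel, Real.exp_zero, one_mul] at this

/-- The competitor is the solution whose datum is frozen at the value `U 0 z`: it is constant in
space and follows the differential equation. -/
theorem IsPlaneSolution.norm_sub_odeFlow_le {ε T L : ℝ} {U : ℝ → Plane → Plane}
    (hU : IsPlaneSolution ε T U) (hL : 0 ≤ L) (hLip : ∀ x y, ‖U 0 x - U 0 y‖ ≤ L * ‖x - y‖)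
    {t : ℝ} (ht : t ∈ Icc 0 T) (x z : Plane) :
    ‖U t x - odeFlow t (U 0 z)‖ ≤ Real.exp t * (L * √(‖x - z‖ ^ 2 + 4 * ε ^ 2 * t)) :=
  hU.norm_sub_le_sqrt (isPlaneSolution_odeFlow ε T (U 0 z)) hL
    (fun x => by simpa [odeFlow_zero] using hLip x z) ht x

/-- A translate is again a solution, so comparison shows that the Lipschitz constant grows at most
like `eᵗ`. This replaces a gradient bound. -/
theorem IsPlaneSolution.norm_translate_sub_le {ε T L : ℝ} {U : ℝ → Plane → Plane}
    (hU : IsPlaneSolution ε T U) (hL : 0 ≤ L) (hLip : ∀ x y, ‖U 0 x - U 0 y‖ ≤ L * ‖x - y‖)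
    {t : ℝ} (ht : t ∈ Icc 0 T) (x h : Plane) :
    ‖U t (x + h) - U t x‖ ≤ Real.exp t * (L * ‖h‖) := by
  have := (hU.translate h).norm_sub_le hU (a := L * ‖h‖) (b := 0) (z := 0) (by positivity) le_rfl
    (fun x => by simpa using hLip (x + h) x) ht x
  simpa using this

/-- Near a zero of its initial datum, a solution is close to its linearization. -/
theorem IsPlaneSolution.norm_translate_sub_clm_le {ε T L κ K : ℝ} {U : ℝ → Plane → Plane}
    (hU : IsPlaneSolution ε T U) (hL : 0 ≤ L) (hLip : ∀ x y, ‖U 0 x - U 0 y‖ ≤ L * ‖x - y‖)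
    {z h k : Plane} (hz : U 0 z = 0) (hκ : 0 ≤ κ) (hK : 0 ≤ K)
    (hlin : ∀ x, ‖U 0 (x + h) - U 0 x - k‖ ≤ ‖h‖ * (κ + K * ‖x - z‖ ^ 2))
    {t : ℝ} (ht : t ∈ Icc 0 T) (x : Plane) :
    ‖Real.exp (-t) • (U t (x + h) - U t x) - k‖ ≤ ‖h‖ * (κ + K * (‖x - z‖ ^ 2 + 4 * ε ^ 2 * t)
      + 3 * L ^ 3 * Real.exp t ^ 2 * (‖x - z‖ ^ 2 + ‖h‖ ^ 2 + 4 * ε ^ 2 * t)) := by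
  have hsq : ∀ t ∈ Icc 0 T, ∀ x,
      ‖U t x‖ ^ 2 ≤ Real.exp t ^ 2 * (L ^ 2 * (‖x - z‖ ^ 2 + 4 * ε ^ 2 * t)) := by
    intro t ht x
    have h1 := hU.norm_sub_odeFlow_le hL hLip ht x z
    rw [hz, odeFlow_zero_right, sub_zero] at h1
    have h2 : 0 ≤ ‖x - z‖ ^ 2 + 4 * ε ^ 2 * t := by have := ht.1; positivity
    calc ‖U t x‖ ^ 2 ≤ (Real.exp t * (L * √(‖x - z‖ ^ 2 + 4 * ε ^ 2 * t))) ^ 2 := by gcongr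
      _ = _ := by rw [mul_pow, mul_pow, Real.sq_sqrt h2]
  have hexp : ∀ t : ℝ, HasDerivAt (fun s : ℝ => Real.exp s ^ 2) (2 * Real.exp t ^ 2) t := fun t => by
    refine ((Real.hasDerivAt_exp t).pow 2).congr_deriv ?_
    ring
  have hq : ∀ t, HasDerivAt (fun s : ℝ => 4 * ε ^ 2 * s) (4 * ε ^ 2) t := fun t => by
    simpa using (hasDerivAt_id t).const_mul (4 * ε ^ 2)
  -- Monotonicity is of no help once `k` is subtracted, so the cubic difference is treated as a
  -- source, of size `6 L³ e²ᵗ (|x - z|² + |h|² + 4ε²t) |h|` after rescaling. Integrating `e²ᵗ`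
  -- halves the 6 into the 3 of the barrier; the summands `4ε²t` absorb the Laplacian.
  have H := (hU.translate h).norm_exp_smul_sub_le hU (k := k) (z := z)
    (α := fun t => ‖h‖ * (κ + K * (4 * ε ^ 2 * t)
      + 3 * L ^ 3 * (Real.exp t ^ 2 * (‖h‖ ^ 2 + 4 * ε ^ 2 * t))))
    (β := fun t => ‖h‖ * (K + 3 * L ^ 3 * Real.exp t ^ 2))
    (α' := fun t => ‖h‖ * (K * (4 * ε ^ 2)
      + 3 * L ^ 3 * (2 * Real.exp t ^ 2 * (‖h‖ ^ 2 + 4 * ε ^ 2 * t)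
        + Real.exp t ^ 2 * (4 * ε ^ 2))))
    (β' := fun t => ‖h‖ * (3 * L ^ 3 * (2 * Real.exp t ^ 2))) ?_ ?_ ?_ ?_ ?_ ?_ t ht x
  · refine H.trans_eq ?_
    ring
  · intro t
    exact ((((hq t).const_mul K).const_add κ).add
      (((hexp t).mul ((hq t).const_add _)).const_mul (3 * L ^ 3))).const_mul ‖h‖
  · intro t
    exact (((hexp t).const_mul (3 * L ^ 3)).const_add K).const_mul ‖h‖
  · intro t ht; have := ht.1; positivity
  · intro t ht; positivity
  · intro x
    refine (hlin x).trans ?_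
    have h0 : 0 ≤ ‖h‖ * (3 * L ^ 3 * (‖h‖ ^ 2 + ‖x - z‖ ^ 2)) := by positivity
    simp only [Real.exp_zero]
    nlinarith only [h0]
  · intro t ht x
    have ht' : t ∈ Icc 0 T := ⟨ht.1.le, ht.2⟩
    set V := Real.exp (-t) • (U t (x + h) - U t x) - k
    have h1 : -⟪cubic (U t (x + h)) - cubic (U t x), V⟫_ℝ
        ≤ ‖cubic (U t (x + h)) - cubic (U t x)‖ * ‖V‖ := by
      rw [← inner_neg_left, ← norm_neg (cubic (U t (x + h)) - cubic (U t x))]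
      exact real_inner_le_norm _ _
    have h2 := norm_cubic_sub_le (U t (x + h)) (U t x)
    have h3 := hU.norm_translate_sub_le hL hLip ht' x h
    have h4 := hsq t ht' (x + h)
    have h5 := hsq t ht' x
    have h6 : ‖x + h - z‖ ^ 2 ≤ 2 * (‖x - z‖ ^ 2 + ‖h‖ ^ 2) := by
      have h7 : ‖x + h - z‖ ≤ ‖x - z‖ + ‖h‖ := by
        rw [show x + h - z = (x - z) + h by abel]; exact norm_add_le _ _
      calc ‖x + h - z‖ ^ 2 ≤ (‖x - z‖ + ‖h‖) ^ 2 := by gcongr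
        _ ≤ _ := add_sq_le
    have h8 : ‖U t (x + h)‖ ^ 2 + ‖U t x‖ ^ 2
        ≤ Real.exp t ^ 2 * (L ^ 2 * (4 * (‖x - z‖ ^ 2 + ‖h‖ ^ 2 + 4 * ε ^ 2 * t))) := by
      calc ‖U t (x + h)‖ ^ 2 + ‖U t x‖ ^ 2
          ≤ Real.exp t ^ 2 * (L ^ 2 * (2 * (‖x - z‖ ^ 2 + ‖h‖ ^ 2) + 4 * ε ^ 2 * t))
            + Real.exp t ^ 2 * (L ^ 2 * (‖x - z‖ ^ 2 + 4 * ε ^ 2 * t)) := by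
              refine add_le_add (h4.trans ?_) h5
              gcongr
        _ = Real.exp t ^ 2 * (L ^ 2 * (3 * ‖x - z‖ ^ 2 + 2 * ‖h‖ ^ 2 + 2 * (4 * ε ^ 2 * t))) := by
              ring
        _ ≤ _ := by
              have : 0 ≤ 4 * ε ^ 2 * t := by have := ht.1; positivity
              gcongr
              nlinarith [sq_nonneg ‖x - z‖, sq_nonneg ‖h‖]
    have h9 : ‖cubic (U t (x + h)) - cubic (U t x)‖ ≤ Real.exp t *
        (‖h‖ * (6 * L ^ 3 * Real.exp t ^ 2 * (‖x - z‖ ^ 2 + ‖h‖ ^ 2 + 4 * ε ^ 2 * t))) := by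
      refine h2.trans ?_
      calc 3 / 2 * (‖U t (x + h)‖ ^ 2 + ‖U t x‖ ^ 2) * ‖U t (x + h) - U t x‖
          ≤ 3 / 2 * (Real.exp t ^ 2 * (L ^ 2 * (4 * (‖x - z‖ ^ 2 + ‖h‖ ^ 2 + 4 * ε ^ 2 * t))))
            * (Real.exp t * (L * ‖h‖)) := by
              have := ht.1
              gcongr
        _ = _ := by ring
    refine h1.trans ((mul_le_mul_of_nonneg_right h9 (norm_nonneg V)).trans_eq ?_)
    ring

/-! ### Periodicity -/

theorem periodicLift_add (f : Torus → Plane) {n : Plane} (hn : n ∈ intLattice) (x : Plane) :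
    periodicLift f (x + n) = periodicLift f x :=
  congrArg f (QuotientAddGroup.mk_add_of_mem x hn)

theorem exists_add_eq_of_mk_eq {x y : Plane} (h : (QuotientAddGroup.mk x : Torus) = QuotientAddGroup.mk y) :
    ∃ n ∈ intLattice, x + n = y :=
  ⟨-x + y, QuotientAddGroup.eq.1 h, by abel⟩

theorem exists_lattice_norm_add_le (x : Plane) : ∃ n ∈ intLattice, ‖x + n‖ ≤ 2 := by
  refine ⟨!₂[-(⌊x 0⌋ : ℝ), -(⌊x 1⌋ : ℝ)], ?_, ?_⟩
  · intro i
    fin_cases i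
    · exact ⟨-⌊x 0⌋, by simp⟩
    · exact ⟨-⌊x 1⌋, by simp⟩
  · have h0 := Int.fract_nonneg (x 0)
    have h0' := (Int.fract_lt_one (x 0)).le
    have h1 := Int.fract_nonneg (x 1)
    have h1' := (Int.fract_lt_one (x 1)).le
    rw [EuclideanSpace.norm_eq, Real.sqrt_le_left (by norm_num)]
    have e0 : x 0 + -(⌊x 0⌋ : ℝ) = Int.fract (x 0) := by rw [Int.fract]; ring
    have e1 : x 1 + -(⌊x 1⌋ : ℝ) = Int.fract (x 1) := by rw [Int.fract]; ring
    simp only [Fin.sum_univ_two, PiLp.add_apply, Real.norm_eq_abs, sq_abs]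
    simp only [Matrix.cons_val_zero, Matrix.cons_val_one, e0, e1]
    nlinarith

section Periodic

variable {F : Type*} [NormedAddCommGroup F] {g : Plane → F}

theorem exists_norm_le_of_periodic (hg : Continuous g)
    (hper : ∀ n ∈ intLattice, ∀ x, g (x + n) = g x) : ∃ M, ∀ x, ‖g x‖ ≤ M := by
  obtain ⟨M, hM⟩ := (isCompact_closedBall (0 : Plane) 2).exists_bound_of_continuousOn
    hg.continuousOn
  refine ⟨M, fun x => ?_⟩
  obtain ⟨n, hn, hx⟩ := exists_lattice_norm_add_le x
  rw [← hper n hn x]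
  exact hM _ (by simpa using hx)

theorem exists_modulus_of_periodic (hg : Continuous g)
    (hper : ∀ n ∈ intLattice, ∀ x, g (x + n) = g x) {κ : ℝ} (hκ : 0 < κ) :
    ∃ r, 0 < r ∧ ∀ x y, ‖x - y‖ ≤ r → ‖g x - g y‖ ≤ κ := by
  -- Radius 3 leaves room for `y + n`, within distance 1 of a point of the ball of radius 2.
  have huc := (isCompact_closedBall (0 : Plane) 3).uniformContinuousOn_of_continuous
    hg.continuousOn
  obtain ⟨δ, hδ, h⟩ := Metric.uniformContinuousOn_iff.1 huc κ hκ
  refine ⟨min (δ / 2) 1, by positivity, fun x y hxy => ?_⟩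
  obtain ⟨n, hn, hx⟩ := exists_lattice_norm_add_le x
  rw [← hper n hn x, ← hper n hn y, ← dist_eq_norm]
  have hsub : x + n - (y + n) = x - y := by abel
  refine (h _ ?_ _ ?_ ?_).le
  · rw [mem_closedBall_zero_iff]; linarith
  · rw [mem_closedBall_zero_iff]
    have h1 : ‖y + n‖ ≤ ‖x + n‖ + ‖x - y‖ := by
      have : y + n = (x + n) - (x - y) := by abel
      rw [this]; exact norm_sub_le _ _
    have := hxy.trans (min_le_right _ _)
    linarith
  · rw [dist_eq_norm, hsub]
    have := hxy.trans (min_le_left _ _)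
    linarith

end Periodic

theorem fderiv_periodicLift_add (f : Torus → Plane) {n : Plane} (hn : n ∈ intLattice) (x : Plane) :
    fderiv ℝ (periodicLift f) (x + n) = fderiv ℝ (periodicLift f) x := by
  rw [← fderiv_comp_add_right]
  congr 1
  funext y
  exact periodicLift_add f hn y

theorem GinzburgLandau.IsSolution.isPlaneSolution {ε : ℝ} {u₀ : Torus → Plane}
    {u : ℝ → Torus → Plane} (h : IsSolution ε u₀ u) (T : ℝ) :
    IsPlaneSolution ε T fun t => periodicLift (u t) where
  continuousOn := h.continuous.mono (prod_mono_left Icc_subset_Ici_self)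
  bounded := by
    have hK : IsCompact (Icc 0 T ×ˢ closedBall (0 : Plane) 2) :=
      isCompact_Icc.prod (isCompact_closedBall _ _)
    obtain ⟨M, hM⟩ := hK.exists_bound_of_continuousOn
      (h.continuous.mono (prod_mono Icc_subset_Ici_self (subset_univ _)))
    refine ⟨M, fun t ht x => ?_⟩
    obtain ⟨n, hn, hx⟩ := exists_lattice_norm_add_le x
    rw [← periodicLift_add _ hn]
    exact hM (t, x + n) ⟨ht, by simpa using hx⟩
  contDiff t ht := h.contDiff_space t ht.1
  hasDerivAt t ht x := by
    have h1 := (h.differentiable_time t ht.1 x).hasDerivAt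
    have h2 := h.equation t ht.1 x
    rw [sub_eq_iff_eq_add] at h2
    rw [h2] at h1
    refine h1.congr_deriv ?_
    rw [cubic]
    module

/-! ### Quantitative linearization of differentiable maps -/

theorem norm_sub_le_of_norm_fderiv_le {f : Plane → Plane} {L : ℝ} (hf : Differentiable ℝ f)
    (hL : ∀ x, ‖fderiv ℝ f x‖ ≤ L) (x y : Plane) : ‖f x - f y‖ ≤ L * ‖x - y‖ :=
  convex_univ.norm_image_sub_le_of_norm_fderiv_le (fun x _ => hf x) (fun x _ => hL x)
    (mem_univ y) (mem_univ x)

theorem norm_sub_sub_fderiv_le {f : Plane → Plane} {κ r : ℝ} (hf : Differentiable ℝ f)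
    (hr : ∀ x y, ‖x - y‖ ≤ r → ‖fderiv ℝ f x - fderiv ℝ f y‖ ≤ κ) {x y z : Plane}
    (hx : x ∈ closedBall z r) (hy : y ∈ closedBall z r) :
    ‖f x - f y - fderiv ℝ f z (x - y)‖ ≤ κ * ‖x - y‖ :=
  (convex_closedBall z r).norm_image_sub_le_of_norm_fderiv_le' (fun x _ => hf x)
    (fun w hw => hr w z (mem_closedBall_iff_norm.1 hw)) hy hx

/-- A global form of the linearization at `z`, with a quadratic error. -/
theorem norm_add_sub_sub_fderiv_le {f : Plane → Plane} {κ r L : ℝ} (hf : Differentiable ℝ f)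
    (hL : ∀ x, ‖fderiv ℝ f x‖ ≤ L) (hr0 : 0 < r) (hκ : 0 ≤ κ)
    (hr : ∀ x y, ‖x - y‖ ≤ r → ‖fderiv ℝ f x - fderiv ℝ f y‖ ≤ κ) (x z : Plane) {h : Plane}
    (hh : ‖h‖ ≤ r / 2) :
    ‖f (x + h) - f x - fderiv ℝ f z h‖ ≤ ‖h‖ * (κ + 8 * L / r ^ 2 * ‖x - z‖ ^ 2) := by
  have hL0 : 0 ≤ L := (norm_nonneg _).trans (hL 0)
  rcases le_total ‖x - z‖ (r / 2) with hx | hx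
  · have h1 := norm_sub_sub_fderiv_le hf hr (x := x + h) (y := x) (z := z) (by
      rw [mem_closedBall_iff_norm, show x + h - z = (x - z) + h by abel]
      exact (norm_add_le _ _).trans (by linarith)) (by
      rw [mem_closedBall_iff_norm]; linarith)
    rw [add_sub_cancel_left] at h1
    refine h1.trans ?_
    have : 0 ≤ ‖h‖ * (8 * L / r ^ 2 * ‖x - z‖ ^ 2) := by positivity
    linarith
  -- Far from `z` the crude bound `2 L |h|` is enough: the constant `8 L / r²` makes the quadratic
  -- at least `2 L` there. The barrier argument needs the bound on the whole plane.
  · have h1 := norm_sub_le_of_norm_fderiv_le hf hL (x + h) x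
    rw [add_sub_cancel_left] at h1
    have h2 : ‖fderiv ℝ f z h‖ ≤ L * ‖h‖ := (fderiv ℝ f z).le_of_opNorm_le (hL z) h
    have h3 : 2 * L ≤ 8 * L / r ^ 2 * ‖x - z‖ ^ 2 := by
      calc 2 * L = 8 * L / r ^ 2 * (r / 2) ^ 2 := by field_simp; ring
        _ ≤ _ := by gcongr
    calc ‖f (x + h) - f x - fderiv ℝ f z h‖ ≤ L * ‖h‖ + L * ‖h‖ :=
          (norm_sub_le _ _).trans (add_le_add h1 h2)
      _ = ‖h‖ * (2 * L) := by ring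
      _ ≤ _ := by gcongr; linarith

/-! ### Linear maps of the plane and their perturbations -/

/-- The identification of the plane with `ℂ`. -/
noncomputable def toComplex : Plane ≃ₗᵢ[ℝ] ℂ := Complex.orthonormalBasisOneI.repr.symm

theorem toComplex_unitVec (θ : ℝ) : toComplex (unitVec θ) = Complex.exp (θ * Complex.I) := by
  rw [toComplex, Complex.orthonormalBasisOneI_repr_symm_apply, Complex.exp_mul_I]
  simp [unitVec]

/-- A real-linear map of `ℂ` is `w ↦ a w + b w̄`, with Wirtinger coefficients read off from the
images of `1` and `i`. Both the least expansion and the degree can be seen from `|a|` and `|b|`. -/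
theorem exists_complex_form (A : Plane →L[ℝ] Plane) : ∃ a b : ℂ,
    (∀ h, toComplex (A h) = a * toComplex h + b * (starRingEnd ℂ) (toComplex h)) ∧
    A.det = ‖a‖ ^ 2 - ‖b‖ ^ 2 ∧ ‖a‖ ≤ ‖A‖ ∧ ‖b‖ ≤ ‖A‖ := by
  set B : ℂ →ₗ[ℝ] ℂ := (toComplex.toLinearEquiv : Plane →ₗ[ℝ] ℂ) ∘ₗ (A : Plane →ₗ[ℝ] Plane) ∘ₗ
    (toComplex.toLinearEquiv.symm : ℂ →ₗ[ℝ] Plane) with hB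
  have hBA : ∀ h, toComplex (A h) = B (toComplex h) := fun h => by simp [hB]
  have hBn : ∀ w, ‖B w‖ ≤ ‖A‖ * ‖w‖ := fun w => by
    have := A.le_opNorm (toComplex.symm w)
    simpa [hB] using this
  have hdet : A.det = LinearMap.det B := (LinearMap.det_conj _ _).symm
  have hlin : ∀ w : ℂ, B w = w.re * B 1 + w.im * B Complex.I := fun w => by
    conv_lhs => rw [← Complex.re_add_im w]
    have h1 : (w.re : ℂ) + w.im * Complex.I = w.re • (1 : ℂ) + w.im • Complex.I := by simp
    rw [h1, map_add, map_smul, map_smul]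
    simp
  have h1 := hBn 1
  have hI := hBn Complex.I
  simp only [norm_one, Complex.norm_I, mul_one] at h1 hI
  refine ⟨(B 1 - Complex.I * B Complex.I) / 2, (B 1 + Complex.I * B Complex.I) / 2, ?_, ?_, ?_, ?_⟩
  · intro h
    rw [hBA, hlin]
    apply Complex.ext <;> simp <;> ring
  · rw [hdet, ← LinearMap.det_toMatrix Complex.basisOneI, Matrix.det_fin_two]
    simp only [LinearMap.toMatrix_apply, Complex.coe_basisOneI, Complex.coe_basisOneI_repr,
      ← Complex.normSq_eq_norm_sq, Complex.normSq_apply]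
    simp
    ring
  · rw [norm_div, Complex.norm_ofNat]
    have := norm_sub_le (B 1) (Complex.I * B Complex.I)
    rw [norm_mul, Complex.norm_I] at this
    linarith
  · rw [norm_div, Complex.norm_ofNat]
    have := norm_add_le (B 1) (Complex.I * B Complex.I)
    rw [norm_mul, Complex.norm_I] at this
    linarith

/-- The map expands by at least `||a| - |b||`, whose product with `|a| + |b| ≤ 2 L` is `|det A|`. -/
theorem le_norm_clm_apply {A : Plane →L[ℝ] Plane} {δ L : ℝ} (hL : 0 < L) (hA : ‖A‖ ≤ L)
    (hδ : δ ≤ |A.det|) (h : Plane) : δ / (2 * L) * ‖h‖ ≤ ‖A h‖ := by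
  obtain ⟨a, b, hab, hdet, ha, hb⟩ := exists_complex_form A
  have h1 : |‖a‖ - ‖b‖| * ‖h‖ ≤ ‖A h‖ := by
    rw [← toComplex.norm_map (A h), hab, ← toComplex.norm_map h]
    have h2 := abs_norm_sub_norm_le (a * toComplex h) (-(b * (starRingEnd ℂ) (toComplex h)))
    rw [sub_neg_eq_add, norm_neg, norm_mul, norm_mul, RCLike.norm_conj, ← sub_mul, abs_mul,
      abs_norm] at h2
    exact h2
  refine le_trans ?_ h1
  gcongr
  rw [div_le_iff₀ (by positivity)]
  calc δ ≤ |‖a‖ - ‖b‖| * |‖a‖ + ‖b‖| := by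
        refine hδ.trans_eq ?_
        rw [hdet, ← abs_mul]; ring_nf
    _ ≤ |‖a‖ - ‖b‖| * (2 * L) := by
        gcongr
        rw [abs_of_nonneg (by positivity)]
        linarith

/-- A quantitative inverse function theorem. -/
theorem exists_zero_of_approx_clm {f : Plane → Plane} {A : Plane →L[ℝ] Plane} {m ρ : ℝ} {z : Plane}
    (hm : 0 < m) (hρ : 0 ≤ ρ) (hA : ∀ h, m * ‖h‖ ≤ ‖A h‖)
    (hf : ∀ x ∈ closedBall z ρ, ∀ y ∈ closedBall z ρ, ‖f x - f y - A (x - y)‖ ≤ m / 2 * ‖x - y‖)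
    (hz : ‖f z‖ ≤ m / 2 * ρ) : ∃ x ∈ closedBall z ρ, f x = 0 := by
  have hinj : Function.Injective (A : Plane →ₗ[ℝ] Plane) := by
    rw [← LinearMap.ker_eq_bot, LinearMap.ker_eq_bot']
    intro h hh
    have h1 := hA h
    rw [show A h = 0 from hh, norm_zero] at h1
    exact norm_le_zero_iff.1 (by nlinarith [norm_nonneg h])
  have hsurj : Function.Surjective A := LinearMap.injective_iff_surjective.1 hinj
  choose inv hinv using hsurj
  let S : A.NonlinearRightInverse :=
    { toFun := inv
      nnnorm := (m⁻¹).toNNReal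
      bound' := fun y => by
        have := hA (inv y)
        rw [hinv] at this
        rw [Real.coe_toNNReal _ (by positivity), inv_mul_eq_div, le_div_iff₀ hm]
        linarith
      right_inv' := hinv }
  have happ : ApproximatesLinearOn f A (closedBall z ρ) (m / 2).toNNReal := by
    intro x hx y hy
    rw [Real.coe_toNNReal _ (by positivity)]
    exact hf x hx y hy
  -- The image contains the ball about `f z` of radius `(m - m / 2) ρ`.
  obtain ⟨x, hx, hx0⟩ := happ.surjOn_closedBall_of_nonlinearRightInverse S hρ le_rfl
    (show (0 : Plane) ∈ _ by
      rw [mem_closedBall, dist_zero_left]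
      simp only [S, Real.coe_toNNReal _ (inv_nonneg.2 hm.le),
        Real.coe_toNNReal _ (half_pos hm).le, inv_inv]
      linarith)
  exact ⟨x, hx, hx0⟩

/-! ### The topological degree -/

/-- A Rouché argument: the quotient of `g` by `c e^(inθ)` stays in the unit disc about 1, where the
principal argument is continuous. It returns to its initial value, so only `nθ` contributes to the
increment. -/
theorem exists_arg_of_norm_sub_lt {g : ℝ → ℂ} {c : ℂ} (n : ℤ)
    (hg : ContinuousOn g (Icc 0 (2 * Real.pi))) (hper : g (2 * Real.pi) = g 0)
    (h : ∀ θ ∈ Icc 0 (2 * Real.pi), ‖g θ - c * Complex.exp (n * θ * Complex.I)‖ < ‖c‖) :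
    ∃ φ : ℝ → ℝ, ContinuousOn φ (Icc 0 (2 * Real.pi)) ∧
      (∀ θ ∈ Icc 0 (2 * Real.pi), g θ = ‖g θ‖ * Complex.exp (φ θ * Complex.I)) ∧
      φ (2 * Real.pi) - φ 0 = 2 * Real.pi * n := by
  have hc : c ≠ 0 := by
    have := (norm_nonneg _).trans_lt (h 0 ⟨le_rfl, by positivity⟩)
    exact norm_pos_iff.1 this
  set e : ℝ → ℂ := fun θ => c * Complex.exp (n * θ * Complex.I) with he
  have he0 : ∀ θ, e θ ≠ 0 := fun θ => mul_ne_zero hc (Complex.exp_ne_zero _)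
  have hen : ∀ θ, ‖e θ‖ = ‖c‖ := fun θ => by
    have : (n * θ * Complex.I : ℂ) = ((n * θ : ℝ) : ℂ) * Complex.I := by push_cast; ring
    rw [he]
    simp only [norm_mul, this, Complex.norm_exp_ofReal_mul_I, mul_one]
  have hec : Continuous e := by simp only [he]; fun_prop
  have hq : ContinuousOn (fun θ => g θ / e θ) (Icc 0 (2 * Real.pi)) :=
    hg.div hec.continuousOn fun θ _ => he0 θ
  have hslit : ∀ θ ∈ Icc 0 (2 * Real.pi), g θ / e θ ∈ Complex.slitPlane := by
    intro θ hθ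
    have h1 : ‖g θ / e θ - 1‖ < 1 := by
      rw [div_sub_one (he0 θ), norm_div, hen, div_lt_one (norm_pos_iff.2 hc)]
      exact h θ hθ
    left
    have h2 := (Complex.abs_re_le_norm _).trans_lt h1
    rw [Complex.sub_re, Complex.one_re, abs_lt] at h2
    linarith
  refine ⟨fun θ => n * θ + Complex.arg c + Complex.arg (g θ / e θ), ?_, ?_, ?_⟩
  · refine ContinuousOn.add (by fun_prop) ?_
    intro θ hθ
    exact ContinuousAt.comp_continuousWithinAt (f := fun θ => g θ / e θ)
      (Complex.continuousAt_arg (hslit θ hθ)) (hq θ hθ)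
  · intro θ hθ
    have h1 : g θ = g θ / e θ * e θ := (div_mul_cancel₀ _ (he0 θ)).symm
    have h2 : ‖g θ‖ = ‖g θ / e θ‖ * ‖c‖ := by
      conv_lhs => rw [h1, norm_mul, hen]
    have h3 := Complex.norm_mul_exp_arg_mul_I (g θ / e θ)
    have h4 := Complex.norm_mul_exp_arg_mul_I c
    calc g θ = g θ / e θ * (c * Complex.exp (n * θ * Complex.I)) := h1
      _ = ‖g θ / e θ‖ * Complex.exp (Complex.arg (g θ / e θ) * Complex.I)
          * (‖c‖ * Complex.exp (Complex.arg c * Complex.I) * Complex.exp (n * θ * Complex.I)) := by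
        rw [h3, h4]
      _ = _ := by
        rw [h2]
        push_cast
        rw [add_mul, add_mul, Complex.exp_add, Complex.exp_add]
        ring
  · have h5 : e (2 * Real.pi) = e 0 := by
      simp only [he]
      congr 1
      have : (n * ((2 * Real.pi : ℝ) : ℂ) * Complex.I : ℂ) = n * (2 * Real.pi * Complex.I) := by
        push_cast; ring
      rw [this, Complex.exp_int_mul_two_pi_mul_I]
      simp
    simp only [hper, h5]
    ring

theorem hasDegreeAt_of_forall_circle {f : Plane → Plane} {z : Plane} {R : ℝ} {c : ℂ} (n : ℤ)
    (hf : Continuous f) (hz : f z = 0) (hR : 0 < R)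
    (hne : ∀ x, x ≠ z → ‖x - z‖ ≤ R → f x ≠ 0)
    (h : ∀ r : ℝ, 0 < r → r ≤ R → ∀ θ : ℝ,
      ‖toComplex (f (z + r • unitVec θ)) - (r * c) * Complex.exp (n * θ * Complex.I)‖
        < ‖(r * c : ℂ)‖) :
    HasDegreeAt f z n := by
  refine ⟨hz, R, hR, hne, fun r hr hrR => ?_⟩
  have huv : Continuous unitVec := by
    have : unitVec = fun θ : ℝ => toComplex.symm (Complex.exp (θ * Complex.I)) := by
      funext θ
      rw [← toComplex_unitVec, toComplex.symm_apply_apply]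
    rw [this]
    exact toComplex.symm.continuous.comp (by fun_prop)
  have hcont : Continuous fun θ : ℝ => toComplex (f (z + r • unitVec θ)) :=
    toComplex.continuous.comp (hf.comp (by fun_prop))
  obtain ⟨φ, hφ, hφ2, hφ3⟩ := exists_arg_of_norm_sub_lt n hcont.continuousOn
    (by simp [unitVec]) (fun θ _ => h r hr hrR θ)
  refine ⟨φ, hφ, fun θ hθ => ?_, hφ3⟩
  apply toComplex.injective
  rw [map_smul, toComplex_unitVec, Complex.real_smul]
  have := hφ2 θ hθ
  rwa [toComplex.norm_map] at this

/-- The degree of a perturbation of an invertible linear map is the sign of the determinant. -/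
theorem hasDegreeAt_of_approx_clm {f : Plane → Plane} {A : Plane →L[ℝ] Plane} {z : Plane}
    {δ L κ R : ℝ} (hf : Continuous f) (hz : f z = 0) (hR : 0 < R) (hL : 0 < L) (hA : ‖A‖ ≤ L)
    (hδ : 0 < δ) (hdet : δ ≤ |A.det|) (hκ : κ < δ / (2 * L))
    (happ : ∀ h, ‖h‖ ≤ R → ‖f (z + h) - A h‖ ≤ κ * ‖h‖) :
    HasDegreeAt f z (if 0 < A.det then 1 else -1) := by
  obtain ⟨a, b, hab, hdet', ha, hb⟩ := exists_complex_form A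
  have hgap : δ / (2 * L) ≤ |‖a‖ - ‖b‖| := by
    rw [div_le_iff₀ (by positivity)]
    calc δ ≤ |‖a‖ - ‖b‖| * |‖a‖ + ‖b‖| := by
          refine hdet.trans_eq ?_
          rw [hdet', ← abs_mul]; ring_nf
      _ ≤ |‖a‖ - ‖b‖| * (2 * L) := by
          gcongr
          rw [abs_of_nonneg (by positivity)]
          linarith
  have hne : ∀ x, x ≠ z → ‖x - z‖ ≤ R → f x ≠ 0 := by
    intro x hx hxR h0
    have h1 := happ (x - z) hxR
    rw [add_sub_cancel, h0, zero_sub, norm_neg] at h1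
    have h2 := le_norm_clm_apply hL hA hdet (x - z)
    have h3 : 0 < ‖x - z‖ := norm_pos_iff.2 (sub_ne_zero.2 hx)
    nlinarith
  have hcirc : ∀ r : ℝ, 0 < r → r ≤ R → ∀ θ : ℝ, ‖toComplex (f (z + r • unitVec θ))
      - r * (a * Complex.exp (θ * Complex.I) + b * Complex.exp (-θ * Complex.I))‖ ≤ κ * r := by
    intro r hr hrR θ
    have hn : ‖r • unitVec θ‖ = r := by
      rw [norm_smul, ← toComplex.norm_map, toComplex_unitVec, Complex.norm_exp_ofReal_mul_I,
        Real.norm_eq_abs, abs_of_pos hr, mul_one]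
    have h1 := happ (r • unitVec θ) (by rw [hn]; exact hrR)
    rw [hn, ← toComplex.norm_map, map_sub, hab, map_smul, toComplex_unitVec,
      Complex.real_smul, map_mul, Complex.conj_ofReal, ← Complex.exp_conj, map_mul,
      Complex.conj_ofReal, Complex.conj_I, mul_neg, ← neg_mul] at h1
    refine le_of_eq_of_le ?_ h1
    congr 2
    ring
  have hexp : ∀ θ : ℝ, ‖Complex.exp (θ * Complex.I)‖ = 1 := Complex.norm_exp_ofReal_mul_I
  have hexp' : ∀ θ : ℝ, ‖Complex.exp (-θ * Complex.I)‖ = 1 := fun θ => by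
    rw [← Complex.ofReal_neg]; exact hexp _
  -- On a circle of radius `r`, `A` is `r (a e^(iθ) + b e^(-iθ))`. The sign of the determinant
  -- decides which term dominates, and `κ` is smaller than the gap between `|a|` and `|b|`.
  split_ifs with hpos
  · have hlt : ‖b‖ < ‖a‖ := by
      rw [hdet', sub_pos] at hpos
      exact lt_of_pow_lt_pow_left₀ 2 (norm_nonneg _) hpos
    rw [abs_of_pos (sub_pos.2 hlt)] at hgap
    refine hasDegreeAt_of_forall_circle (c := a) 1 hf hz hR hne fun r hr hrR θ => ?_
    have h2 := norm_add_le (toComplex (f (z + r • unitVec θ))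
      - r * (a * Complex.exp (θ * Complex.I) + b * Complex.exp (-θ * Complex.I)))
      (r * b * Complex.exp (-θ * Complex.I))
    rw [norm_mul (r * b : ℂ), hexp', norm_mul, Complex.norm_real, Real.norm_eq_abs,
      abs_of_pos hr] at h2
    have h3 := hcirc r hr hrR θ
    rw [norm_mul, Complex.norm_real, Real.norm_eq_abs, abs_of_pos hr, Int.cast_one, one_mul]
    refine lt_of_eq_of_lt ?_ (h2.trans_lt (show _ < r * ‖a‖ by nlinarith))
    congr 1
    ring
  · have hlt : ‖a‖ < ‖b‖ := by
      have h0 : A.det < 0 := by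
        refine lt_of_le_of_ne (not_lt.1 hpos) fun h0 => ?_
        rw [h0, abs_zero] at hdet
        linarith
      rw [hdet', sub_neg] at h0
      exact lt_of_pow_lt_pow_left₀ 2 (norm_nonneg _) h0
    rw [abs_of_neg (sub_neg.2 hlt)] at hgap
    refine hasDegreeAt_of_forall_circle (c := b) (-1) hf hz hR hne fun r hr hrR θ => ?_
    have h2 := norm_add_le (toComplex (f (z + r • unitVec θ))
      - r * (a * Complex.exp (θ * Complex.I) + b * Complex.exp (-θ * Complex.I)))
      (r * a * Complex.exp (θ * Complex.I))
    rw [norm_mul (r * a : ℂ), hexp, norm_mul, Complex.norm_real, Real.norm_eq_abs,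
      abs_of_pos hr] at h2
    have h3 := hcirc r hr hrR θ
    rw [norm_mul, Complex.norm_real, Real.norm_eq_abs, abs_of_pos hr, Int.cast_neg, Int.cast_one,
      neg_one_mul]
    refine lt_of_eq_of_lt ?_ (h2.trans_lt (show _ < r * ‖b‖ by nlinarith))
    congr 1
    ring

theorem hasTorusDegreeAt_mk {f : Torus → Plane} {x : Plane} {d : ℤ}
    (h : HasDegreeAt (periodicLift f) x d) :
    HasTorusDegreeAt f (QuotientAddGroup.mk x) d := by
  intro y hy
  obtain ⟨n, hn, rfl⟩ := exists_add_eq_of_mk_eq hy.symm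
  obtain ⟨h0, R, hR, hne, hφ⟩ := h
  refine ⟨(periodicLift_add f hn x).trans h0, R, hR, ?_, ?_⟩
  · intro y hy hyR h1
    have h2 : y = (y - n) + n := by abel
    rw [h2, periodicLift_add f hn] at h1
    refine hne (y - n) ?_ ?_ h1
    · rintro rfl; exact hy h2
    · rwa [show y - n - x = y - (x + n) by abel]
  · intro r hr hrR
    have h3 : ∀ w, periodicLift f (x + n + w) = periodicLift f (x + w) := fun w => by
      rw [add_right_comm, periodicLift_add f hn]
    simpa only [h3] using hφ r hr hrR

/-! ### Zeros of nondegenerate data and of the solutions that start from them -/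

/-- A nondegenerate vector field `f` with quantitative bounds: `L` bounds its gradient `Df`, which
oscillates by at most `m / 4` at scale `r`, where `m = α₀ / (4 L)`. -/
structure NondegenerateDatum (f : Plane → Plane) (α₀ L m r : ℝ) : Prop where
  differentiable : Differentiable ℝ f
  nondeg_pos : 0 < α₀
  lip_pos : 0 < L
  radius_pos : 0 < r
  m_eq : m = α₀ / 2 / (2 * L)
  norm_fderiv_le : ∀ x, ‖fderiv ℝ f x‖ ≤ L
  modulus : ∀ x y, ‖x - y‖ ≤ r → ‖fderiv ℝ f x - fderiv ℝ f y‖ ≤ m / 4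
  nondeg : ∀ x, α₀ ≤ ‖f x‖ + |(fderiv ℝ f x).det|

namespace NondegenerateDatum

variable {f : Plane → Plane} {α₀ L m r : ℝ}

theorem m_pos (hf : NondegenerateDatum f α₀ L m r) : 0 < m := by
  have := hf.nondeg_pos
  have := hf.lip_pos
  rw [hf.m_eq]; positivity

theorem lipschitz (hf : NondegenerateDatum f α₀ L m r) (x y : Plane) :
    ‖f x - f y‖ ≤ L * ‖x - y‖ :=
  norm_sub_le_of_norm_fderiv_le hf.differentiable hf.norm_fderiv_le x y

/-- Where `|f| ≤ α₀ / 2`, nondegeneracy leaves at least `α₀ / 2` for the determinant. -/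
theorem le_norm_fderiv_apply (hf : NondegenerateDatum f α₀ L m r) {x : Plane}
    (hx : ‖f x‖ ≤ α₀ / 2) (h : Plane) : m * ‖h‖ ≤ ‖fderiv ℝ f x h‖ := by
  rw [hf.m_eq]
  exact le_norm_clm_apply hf.lip_pos (hf.norm_fderiv_le x) (by linarith [hf.nondeg x]) h

theorem le_norm_fderiv_apply_of_zero (hf : NondegenerateDatum f α₀ L m r) {z : Plane}
    (hz : f z = 0) (h : Plane) : m * ‖h‖ ≤ ‖fderiv ℝ f z h‖ :=
  hf.le_norm_fderiv_apply (by rw [hz, norm_zero]; linarith [hf.nondeg_pos]) h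

theorem eq_of_zeros (hf : NondegenerateDatum f α₀ L m r) {z w : Plane} (hz : f z = 0)
    (hw : f w = 0) (hzw : ‖w - z‖ ≤ r) : w = z := by
  have h1 := norm_sub_sub_fderiv_le hf.differentiable hf.modulus (x := w) (y := z) (z := z)
    (mem_closedBall_iff_norm.2 hzw) (mem_closedBall_self hf.radius_pos.le)
  rw [hz, hw, sub_zero, zero_sub, norm_neg] at h1
  have h2 := hf.le_norm_fderiv_apply_of_zero hz (w - z)
  have h3 : ‖w - z‖ ≤ 0 := by nlinarith [hf.m_pos, norm_nonneg (w - z)]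
  exact sub_eq_zero.1 (norm_le_zero_iff.1 h3)

/-- The inverse function theorem is centred at `x`, where the small value of `f` already makes the
derivative invertible; the ball has radius `2 |f x| / m`. -/
theorem exists_zero_near (hf : NondegenerateDatum f α₀ L m r) {x : Plane} (h1 : ‖f x‖ ≤ α₀ / 2)
    (h2 : ‖f x‖ ≤ m / 2 * r) : ∃ z, f z = 0 ∧ m / 2 * ‖x - z‖ ≤ ‖f x‖ := by
  have hm := hf.m_pos
  set ρ := 2 / m * ‖f x‖ with hρ
  have hρ' : m / 2 * ρ = ‖f x‖ := by rw [hρ]; field_simp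
  have hρr : ρ ≤ r := by
    rw [← hρ'] at h2
    exact le_of_mul_le_mul_left h2 (half_pos hm)
  obtain ⟨z, hz, hz0⟩ := exists_zero_of_approx_clm hm (by positivity) (hf.le_norm_fderiv_apply h1)
    (fun y hy w hw => (norm_sub_sub_fderiv_le hf.differentiable hf.modulus
      (closedBall_subset_closedBall hρr hy) (closedBall_subset_closedBall hρr hw)).trans
      (by gcongr; linarith)) hρ'.ge
  refine ⟨z, hz0, ?_⟩
  rw [mem_closedBall_iff_norm'] at hz
  rw [← hρ']
  gcongr

theorem hasDegreeAt (hf : NondegenerateDatum f α₀ L m r) {z : Plane} (hz : f z = 0) :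
    HasDegreeAt f z (if 0 < (fderiv ℝ f z).det then 1 else -1) := by
  have hm := hf.m_pos
  refine hasDegreeAt_of_approx_clm (κ := m / 4) hf.differentiable.continuous hz hf.radius_pos
    hf.lip_pos (hf.norm_fderiv_le z) (half_pos hf.nondeg_pos)
    (by have := hf.nondeg z; rw [hz, norm_zero] at this; linarith [hf.nondeg_pos])
    (by rw [← hf.m_eq]; linarith) fun h hh => ?_
  have := norm_sub_sub_fderiv_le hf.differentiable hf.modulus (x := z + h) (y := z) (z := z)
    (by simpa using hh) (mem_closedBall_self hf.radius_pos.le)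
  simpa [hz] using this

end NondegenerateDatum

/-- The smallness conditions on the length scale `l` of the displacement of the zeros, which stay
within `R l` of their initial positions; `σ` bounds the ratio of `l` and the vortex size. -/
structure IsSmallScale (ε T l σ R α₀ L m r : ℝ) : Prop where
  nonneg : 0 ≤ l
  R_eq : R = 8 * L / m
  diffusion_le : ∀ t ∈ Icc 0 T, ε ^ 2 * t ≤ l ^ 2
  exp_mul_le : ∀ t ∈ Icc 0 T, Real.exp t * l ≤ σ
  radius_le : 4 * (R * l) ≤ r / 2
  curvature_le : 8 * L / r ^ 2 * ((4 * R ^ 2 + 4) * l ^ 2) ≤ m / 8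
  cubic_le : 3 * L ^ 3 * ((20 * R ^ 2 + 4) * σ ^ 2) ≤ m / 8
  sigma_le : 2 * L * σ ≤ 1 / 4
  value_le : 4 * L * l ≤ α₀ / 2
  value_le' : 4 * L * l ≤ m / 2 * r

/-! ### Zeros of the solution at small scale -/

namespace IsPlaneSolution

variable {ε T l σ R α₀ L m r : ℝ} {U : ℝ → Plane → Plane}

/-- Freezing the datum at `x` itself leaves only the diffusion length `√(4ε²t) ≤ 2 l`. -/
theorem norm_sub_odeFlow_le_scale (hU : IsPlaneSolution ε T U)
    (hf : NondegenerateDatum (U 0) α₀ L m r) (hs : IsSmallScale ε T l σ R α₀ L m r)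
    {t : ℝ} (ht : t ∈ Icc 0 T) (x : Plane) :
    ‖U t x - odeFlow t (U 0 x)‖ ≤ Real.exp t * (2 * L * l) := by
  refine (hU.norm_sub_odeFlow_le hf.lip_pos.le hf.lipschitz ht x x).trans ?_
  have h1 : √(‖x - x‖ ^ 2 + 4 * ε ^ 2 * t) ≤ 2 * l := by
    have := hs.nonneg
    rw [Real.sqrt_le_left (by positivity), sub_self, norm_zero]
    linarith [hs.diffusion_le t ht]
  have := hf.lip_pos
  calc Real.exp t * (L * √(‖x - x‖ ^ 2 + 4 * ε ^ 2 * t)) ≤ Real.exp t * (L * (2 * l)) := by gcongr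
    _ = _ := by ring

theorem norm_sub_odeFlow_le_quarter (hU : IsPlaneSolution ε T U)
    (hf : NondegenerateDatum (U 0) α₀ L m r) (hs : IsSmallScale ε T l σ R α₀ L m r)
    {t : ℝ} (ht : t ∈ Icc 0 T) (x : Plane) :
    ‖U t x - odeFlow t (U 0 x)‖ ≤ 1 / 4 := by
  refine (hU.norm_sub_odeFlow_le_scale hf hs ht x).trans (le_trans ?_ hs.sigma_le)
  calc Real.exp t * (2 * L * l) = 2 * L * (Real.exp t * l) := by ring
    _ ≤ 2 * L * σ := mul_le_mul_of_nonneg_left (hs.exp_mul_le t ht) (by linarith [hf.lip_pos])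

theorem norm_initial_le_of_zero (hU : IsPlaneSolution ε T U)
    (hf : NondegenerateDatum (U 0) α₀ L m r) (hs : IsSmallScale ε T l σ R α₀ L m r)
    {t : ℝ} (ht : t ∈ Icc 0 T) {x : Plane} (hx : U t x = 0) : ‖U 0 x‖ ≤ 4 * L * l := by
  have h1 := hU.norm_sub_odeFlow_le_scale hf hs ht x
  have h2 := hU.norm_sub_odeFlow_le_quarter hf hs ht x
  rw [hx, zero_sub, norm_neg] at h1 h2
  -- The minimum with `1/2` makes the bound admissible for inverting the flow and keeps the factor
  -- `eᵗ l`, whose `eᵗ` then cancels.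
  have h3 : ‖odeFlow t (U 0 x)‖ ≤ min (Real.exp t * (2 * L * l)) (1 / 2) :=
    le_min h1 (h2.trans (by norm_num))
  have h4 := exp_mul_norm_le_of_norm_odeFlow_le ht.1 (min_le_right _ _) h3
  have h5 : Real.exp t * ‖U 0 x‖ ≤ Real.exp t * (4 * L * l) :=
    h4.trans (by linarith [min_le_left (Real.exp t * (2 * L * l)) (1 / 2)])
  exact le_of_mul_le_mul_left h5 (Real.exp_pos t)

theorem exists_initial_zero_near (hU : IsPlaneSolution ε T U)
    (hf : NondegenerateDatum (U 0) α₀ L m r) (hs : IsSmallScale ε T l σ R α₀ L m r)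
    {t : ℝ} (ht : t ∈ Icc 0 T) {x : Plane} (hx : U t x = 0) :
    ∃ z, U 0 z = 0 ∧ ‖x - z‖ ≤ R * l := by
  have h1 := hU.norm_initial_le_of_zero hf hs ht hx
  obtain ⟨z, hz, hxz⟩ := hf.exists_zero_near (h1.trans hs.value_le) (h1.trans hs.value_le')
  refine ⟨z, hz, le_of_mul_le_mul_left (hxz.trans (h1.trans_eq ?_)) (half_pos hf.m_pos)⟩
  have := hf.m_pos
  rw [hs.R_eq]
  field_simp
  ring

/-- The error budget is `m / 4` for the oscillation of the initial gradient, `m / 8` for its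
quadratic correction far from `z`, and `m / 8` for the cubic term, controlled by `(eᵗ l)² ≤ σ²`. The
doubled radius leaves room for a disc of radius `R l` about the displaced zero. -/
theorem norm_sub_sub_fderiv_le_scale (hU : IsPlaneSolution ε T U)
    (hf : NondegenerateDatum (U 0) α₀ L m r) (hs : IsSmallScale ε T l σ R α₀ L m r)
    {t : ℝ} (ht : t ∈ Icc 0 T) {x y z : Plane} (hz : U 0 z = 0)
    (hx : x ∈ closedBall z (2 * (R * l))) (hy : y ∈ closedBall z (2 * (R * l))) :
    ‖Real.exp (-t) • (U t x - U t y) - fderiv ℝ (U 0) z (x - y)‖ ≤ m / 2 * ‖x - y‖ := by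
  have hL := hf.lip_pos
  have hm := hf.m_pos
  have hl := hs.nonneg
  have hr := hf.radius_pos
  rw [mem_closedBall_iff_norm] at hx hy
  have hxy : ‖x - y‖ ≤ 4 * (R * l) := by
    rw [show x - y = (x - z) - (y - z) by abel]
    exact (_root_.norm_sub_le _ _).trans (by linarith)
  have h1 := hU.norm_translate_sub_clm_le hL.le hf.lipschitz (z := z) (h := x - y)
    (k := fderiv ℝ (U 0) z (x - y)) (κ := m / 4) (K := 8 * L / r ^ 2) hz (by positivity)
    (by positivity)
    (fun w => norm_add_sub_sub_fderiv_le hf.differentiable hf.norm_fderiv_le hr (by positivity)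
      hf.modulus w z (hxy.trans hs.radius_le)) ht y
  rw [add_sub_cancel] at h1
  refine h1.trans ?_
  rw [mul_comm]
  gcongr
  have h2 : ‖y - z‖ ^ 2 ≤ 4 * R ^ 2 * l ^ 2 := by
    calc ‖y - z‖ ^ 2 ≤ (2 * (R * l)) ^ 2 := by gcongr
      _ = _ := by ring
  have h3 : ‖x - y‖ ^ 2 ≤ 16 * R ^ 2 * l ^ 2 := by
    calc ‖x - y‖ ^ 2 ≤ (4 * (R * l)) ^ 2 := by gcongr
      _ = _ := by ring
  have h4 := hs.diffusion_le t ht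
  have h5 : 8 * L / r ^ 2 * (‖y - z‖ ^ 2 + 4 * ε ^ 2 * t) ≤ m / 8 := by
    refine le_trans ?_ hs.curvature_le
    gcongr
    linarith
  have h6 : 3 * L ^ 3 * Real.exp t ^ 2 * (‖y - z‖ ^ 2 + ‖x - y‖ ^ 2 + 4 * ε ^ 2 * t) ≤ m / 8 := by
    refine le_trans ?_ hs.cubic_le
    calc 3 * L ^ 3 * Real.exp t ^ 2 * (‖y - z‖ ^ 2 + ‖x - y‖ ^ 2 + 4 * ε ^ 2 * t)
        ≤ 3 * L ^ 3 * Real.exp t ^ 2 * ((20 * R ^ 2 + 4) * l ^ 2) := by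
          gcongr
          linarith
      _ = 3 * L ^ 3 * ((20 * R ^ 2 + 4) * (Real.exp t * l) ^ 2) := by ring
      _ ≤ _ := by
          have := hs.exp_mul_le t ht
          gcongr
  linarith

/-- The derivative expands by `m` and the error costs `m / 2`. This gives both uniqueness of the
zero and its continuity in time. -/
theorem mul_norm_sub_le_norm_sub (hU : IsPlaneSolution ε T U)
    (hf : NondegenerateDatum (U 0) α₀ L m r) (hs : IsSmallScale ε T l σ R α₀ L m r)
    {t : ℝ} (ht : t ∈ Icc 0 T) {x y z : Plane} (hz : U 0 z = 0)
    (hx : x ∈ closedBall z (2 * (R * l))) (hy : y ∈ closedBall z (2 * (R * l))) :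
    m / 2 * ‖x - y‖ ≤ ‖U t x - U t y‖ := by
  have h1 := hU.norm_sub_sub_fderiv_le_scale hf hs ht hz hx hy
  have h2 := hf.le_norm_fderiv_apply_of_zero hz (x - y)
  have h3 := norm_le_norm_add_norm_sub (Real.exp (-t) • (U t x - U t y)) (fderiv ℝ (U 0) z (x - y))
  have h4 : ‖Real.exp (-t) • (U t x - U t y)‖ ≤ 1 * ‖U t x - U t y‖ := by
    rw [norm_smul, Real.norm_eq_abs, Real.abs_exp]
    gcongr
    exact Real.exp_le_one_iff.2 (by linarith [ht.1])
  linarith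

theorem R_mul_nonneg (hf : NondegenerateDatum (U 0) α₀ L m r)
    (hs : IsSmallScale ε T l σ R α₀ L m r) : 0 ≤ R * l := by
  have := hf.lip_pos
  have := hf.m_pos
  have := hs.nonneg
  rw [hs.R_eq]
  positivity

theorem eq_of_zeros (hU : IsPlaneSolution ε T U)
    (hf : NondegenerateDatum (U 0) α₀ L m r) (hs : IsSmallScale ε T l σ R α₀ L m r)
    {t : ℝ} (ht : t ∈ Icc 0 T) {x y z : Plane} (hz : U 0 z = 0)
    (hx : x ∈ closedBall z (2 * (R * l))) (hy : y ∈ closedBall z (2 * (R * l)))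
    (hx0 : U t x = 0) (hy0 : U t y = 0) : x = y := by
  have h1 := hU.mul_norm_sub_le_norm_sub hf hs ht hz hx hy
  rw [hx0, hy0, sub_zero, norm_zero] at h1
  have h2 := hf.m_pos
  have h3 : ‖x - y‖ ≤ 0 := by nlinarith [norm_nonneg (x - y)]
  exact sub_eq_zero.1 (norm_le_zero_iff.1 h3)

theorem exists_zero_near (hU : IsPlaneSolution ε T U)
    (hf : NondegenerateDatum (U 0) α₀ L m r) (hs : IsSmallScale ε T l σ R α₀ L m r)
    {t : ℝ} (ht : t ∈ Icc 0 T) {z : Plane} (hz : U 0 z = 0) :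
    ∃ x ∈ closedBall z (R * l), U t x = 0 := by
  have hρ := R_mul_nonneg hf hs
  have hm := hf.m_pos
  have hsub : closedBall z (R * l) ⊆ closedBall z (2 * (R * l)) :=
    closedBall_subset_closedBall (by linarith)
  obtain ⟨x, hx, hx0⟩ := exists_zero_of_approx_clm (f := fun x => Real.exp (-t) • U t x) hm hρ
    (hf.le_norm_fderiv_apply_of_zero hz) (fun x hx y hy => by
      rw [← smul_sub]
      exact hU.norm_sub_sub_fderiv_le_scale hf hs ht hz (hsub hx) (hsub hy)) (by
      have h1 := hU.norm_sub_odeFlow_le_scale hf hs ht z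
      rw [hz, odeFlow_zero_right, sub_zero] at h1
      have h2 := exp_neg_mul_le h1
      rw [norm_smul, Real.norm_eq_abs, Real.abs_exp]
      refine h2.trans ?_
      have h3 : m / 2 * (R * l) = 4 * L * l := by rw [hs.R_eq]; field_simp; ring
      rw [h3]
      have := mul_nonneg hf.lip_pos.le hs.nonneg
      linarith)
  exact ⟨x, hx, (smul_eq_zero.1 hx0).resolve_left (Real.exp_pos _).ne'⟩

theorem hasDegreeAt_of_zero (hU : IsPlaneSolution ε T U)
    (hf : NondegenerateDatum (U 0) α₀ L m r) (hs : IsSmallScale ε T l σ R α₀ L m r) (hl : 0 < l)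
    {t : ℝ} (ht : t ∈ Icc 0 T) {x z : Plane} (hz : U 0 z = 0) (hx : x ∈ closedBall z (R * l))
    (hx0 : U t x = 0) : HasDegreeAt (U t) x (if 0 < (fderiv ℝ (U 0) z).det then 1 else -1) := by
  have hm := hf.m_pos
  have hL := hf.lip_pos
  have hα := hf.nondeg_pos
  have hρ : 0 < R * l := by rw [hs.R_eq]; positivity
  have he := Real.exp_pos t
  set A := fderiv ℝ (U 0) z with hA
  have hdetA : α₀ / 2 ≤ |A.det| := by
    have := hf.nondeg z
    rw [hz, norm_zero] at this
    linarith
  have hcont : Continuous (U t) := by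
    have h1 : ContinuousOn (fun y : Plane => U t y) univ :=
      hU.continuousOn.comp (f := fun y : Plane => (t, y)) (by fun_prop)
        fun y _ => ⟨ht, mem_univ _⟩
    exact continuousOn_univ.1 h1
  have hkey : HasDegreeAt (fun y => Real.exp (-t) • U t y) x (if 0 < A.det then 1 else -1) := by
    refine hasDegreeAt_of_approx_clm (κ := m / 2) (by fun_prop) (by simp [hx0]) hρ hL
      (hf.norm_fderiv_le z) (half_pos hα) hdetA (by rw [← hf.m_eq]; linarith) fun h hh => ?_
    rw [mem_closedBall_iff_norm] at hx
    have h1 := hU.norm_sub_sub_fderiv_le_scale hf hs ht hz (x := x + h) (y := x)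
      (by
        rw [mem_closedBall_iff_norm, show x + h - z = (x - z) + h by abel]
        exact (norm_add_le _ _).trans (by linarith))
      (by rw [mem_closedBall_iff_norm]; linarith)
    rwa [hx0, sub_zero, add_sub_cancel_left] at h1
  -- The positive factor `e⁻ᵗ` changes neither the zeros nor the argument.
  obtain ⟨-, ρ, hρ, hne, harg⟩ := hkey
  refine ⟨hx0, ρ, hρ, fun y hy hyρ h0 => hne y hy hyρ (by simp [h0]), fun s hs0 hsρ => ?_⟩
  obtain ⟨φ, hφ, hφ2, hφ3⟩ := harg s hs0 hsρ
  refine ⟨φ, hφ, fun θ hθ => ?_, hφ3⟩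
  have h1 := hφ2 θ hθ
  rw [norm_smul, Real.norm_eq_abs, Real.abs_exp, mul_smul] at h1
  exact smul_right_injective Plane (Real.exp_pos (-t)).ne' h1

end IsPlaneSolution

/-! ### Zeros on the torus -/

/-- The sign of the Jacobian determinant of a vector field on the torus, as an integer. -/
noncomputable def jacobianSign (f : Torus → Plane) (p : Torus) : ℤ :=
  if 0 < (fderiv ℝ (periodicLift f) p.out).det then 1 else -1

theorem dist_mk_le (x y : Plane) :
    dist (QuotientAddGroup.mk x : Torus) (QuotientAddGroup.mk y) ≤ ‖x - y‖ := by
  rw [dist_eq_norm, ← QuotientAddGroup.mk_sub]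
  exact QuotientAddGroup.norm_mk_le_norm

theorem periodicLift_out (f : Torus → Plane) (p : Torus) : periodicLift f p.out = f p :=
  congrArg f (QuotientAddGroup.out_eq' p)

section Datum

variable {u₀ : Torus → Plane} {α₀ L m r : ℝ}

/-- Distinct zeros of the lift are more than `r` apart, and every class has a representative in a
fixed compact ball, which finitely many balls of radius `r` centred at zeros cover. -/
theorem finite_zeros (hf : NondegenerateDatum (periodicLift u₀) α₀ L m r) : (zeros u₀).Finite := by
  have hK : IsCompact ({x | periodicLift u₀ x = 0} ∩ closedBall (0 : Plane) 2) :=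
    (isCompact_closedBall 0 2).inter_left
      (isClosed_eq hf.differentiable.continuous continuous_const)
  obtain ⟨s, hs, hsfin, hcov⟩ := hK.finite_cover_balls hf.radius_pos
  refine (hsfin.image (QuotientAddGroup.mk : Plane → Torus)).subset fun p hp => ?_
  obtain ⟨x, rfl⟩ := QuotientAddGroup.mk_surjective p
  obtain ⟨n, hn, hx⟩ := exists_lattice_norm_add_le x
  have h0 : periodicLift u₀ (x + n) = 0 := (periodicLift_add u₀ hn x).trans hp
  have hmem := hcov ⟨h0, by simpa using hx⟩
  simp only [mem_iUnion, exists_prop] at hmem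
  obtain ⟨y, hy, hxy⟩ := hmem
  rw [mem_ball_iff_norm] at hxy
  have := hf.eq_of_zeros (hs hy).1 h0 hxy.le
  exact ⟨y, hy, by rw [← this, QuotientAddGroup.mk_add_of_mem x hn]⟩

theorem hasTorusDegreeAt_initial (hf : NondegenerateDatum (periodicLift u₀) α₀ L m r) {p : Torus}
    (hp : p ∈ zeros u₀) : HasTorusDegreeAt u₀ p (jacobianSign u₀ p) := by
  have h := hasTorusDegreeAt_mk (hf.hasDegreeAt ((periodicLift_out u₀ p).trans hp))
  rwa [show (QuotientAddGroup.mk p.out : Torus) = p from QuotientAddGroup.out_eq' p] at h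

/-- At a small scale, the zeros of the solution move little and persist with their degrees. -/
theorem exists_zero_paths {ε T l σ R : ℝ} {u : ℝ → Torus → Plane}
    (hf : NondegenerateDatum (periodicLift u₀) α₀ L m r) (hu : IsSolution ε u₀ u) (hl : 0 < l)
    (hs : IsSmallScale ε T l σ R α₀ L m r) :
    ∃ z : Torus → ℝ → Torus,
      (∀ p ∈ zeros u₀, (0 ∈ Icc 0 T → z p 0 = p) ∧ ContinuousOn (z p) (Icc 0 T)) ∧
      ∀ t ∈ Icc 0 T, BijOn (fun p => z p t) (zeros u₀) (zeros (u t)) ∧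
        ∀ p ∈ zeros u₀, dist (z p t) p ≤ R * l ∧
          HasTorusDegreeAt (u t) (z p t) (jacobianSign u₀ p) := by
  have hU := hu.isPlaneSolution T
  have hini : periodicLift (u 0) = periodicLift u₀ := by rw [hu.initial]
  have hf' : NondegenerateDatum (periodicLift (u 0)) α₀ L m r := by rwa [hini]
  have hρ : 0 ≤ R * l := IsPlaneSolution.R_mul_nonneg (U := fun t => periodicLift (u t)) hf' hs
  have hm := hf.m_pos
  have hsub : ∀ w : Plane, closedBall w (R * l) ⊆ closedBall w (2 * (R * l)) := fun w =>
    closedBall_subset_closedBall (by linarith)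
  have hout : ∀ p ∈ zeros u₀, periodicLift (u 0) p.out = 0 := fun p hp => by
    rw [hini]; exact (periodicLift_out u₀ p).trans hp
  have hmk : ∀ p : Torus, (QuotientAddGroup.mk p.out : Torus) = p := QuotientAddGroup.out_eq'
  have hex : ∀ (p : Torus) (t : ℝ), ∃ x : Plane, p ∈ zeros u₀ → t ∈ Icc 0 T →
      x ∈ closedBall p.out (R * l) ∧ periodicLift (u t) x = 0 := by
    intro p t
    by_cases h : p ∈ zeros u₀ ∧ t ∈ Icc 0 T
    · obtain ⟨x, hx, hx0⟩ := hU.exists_zero_near hf' hs h.2 (hout p h.1)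
      exact ⟨x, fun _ _ => ⟨hx, hx0⟩⟩
    · exact ⟨0, fun h1 h2 => absurd ⟨h1, h2⟩ h⟩
  choose ζ hζ using hex
  refine ⟨fun p t => QuotientAddGroup.mk (ζ p t), fun p hp => ⟨fun h0 => ?_, ?_⟩,
    fun t ht => ⟨⟨?_, ?_, ?_⟩, fun p hp => ⟨?_, ?_⟩⟩⟩
  · obtain ⟨h1, h2⟩ := hζ p 0 hp h0
    have := hU.eq_of_zeros hf' hs h0 (hout p hp) (hsub _ h1)
      (mem_closedBall_self (by linarith)) h2 (hout p hp)
    simp only [this]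
    exact hmk p
  · have hcont : ContinuousOn (ζ p) (Icc 0 T) := by
      intro t ht
      obtain ⟨h1, h2⟩ := hζ p t hp ht
      have hUt : ContinuousOn (fun s => periodicLift (u s) (ζ p t)) (Icc 0 T) :=
        hU.continuousOn.comp (f := fun s : ℝ => (s, ζ p t)) (by fun_prop)
          fun s hs => ⟨hs, mem_univ _⟩
      -- The lower Lipschitz bound gives `|ζ(s) - ζ(t)| ≤ (2 / m) |u(s, ζ(t))|`, which tends to 0 as
      -- `s → t` because `ζ(t)` is a zero at time `t`.
      have hlim : Tendsto (fun s => 2 / m * ‖periodicLift (u s) (ζ p t)‖) (𝓝[Icc 0 T] t) (𝓝 0) := by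
        have := ((hUt t ht).norm.tendsto).const_mul (2 / m)
        rwa [h2, norm_zero, mul_zero] at this
      refine tendsto_iff_norm_sub_tendsto_zero.2 (squeeze_zero' ?_ ?_ hlim)
      · exact Eventually.of_forall fun s => norm_nonneg _
      · filter_upwards [self_mem_nhdsWithin] with s hsT
        obtain ⟨h3, h4⟩ := hζ p s hp hsT
        have h5 := hU.mul_norm_sub_le_norm_sub hf' hs hsT (hout p hp) (hsub _ h3) (hsub _ h1)
        rw [h4, zero_sub, norm_neg] at h5
        rw [div_mul_eq_mul_div, le_div_iff₀ hm]
        linarith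
    exact QuotientAddGroup.continuous_mk.comp_continuousOn hcont
  · intro p hp
    exact (hζ p t hp ht).2
  · intro p hp q hq hpq
    obtain ⟨h1, -⟩ := hζ p t hp ht
    obtain ⟨h2, -⟩ := hζ q t hq ht
    obtain ⟨n, hn, hpn⟩ := exists_add_eq_of_mk_eq hpq
    have h3 : periodicLift (u 0) (p.out + n) = 0 :=
      (periodicLift_add (u 0) hn _).trans (hout p hp)
    rw [mem_closedBall_iff_norm] at h2
    rw [mem_closedBall_iff_norm'] at h1
    -- A common zero at time `t` puts these two initial zeros within `2 R l ≤ r` of each other.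
    have h4 : p.out + n = q.out := by
      refine hf'.eq_of_zeros (hout q hq) h3 ?_
      rw [show p.out + n - q.out = (p.out - ζ p t) + (ζ q t - q.out) by rw [← hpn]; abel]
      refine (norm_add_le _ _).trans ?_
      linarith [hs.radius_le, hf.radius_pos]
    rw [← hmk p, ← hmk q, ← h4, QuotientAddGroup.mk_add_of_mem _ hn]
  · intro q hq
    obtain ⟨x, rfl⟩ := QuotientAddGroup.mk_surjective q
    obtain ⟨w, hw, hxw⟩ := hU.exists_initial_zero_near hf' hs ht (x := x) hq
    set p : Torus := QuotientAddGroup.mk w with hpdef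
    have hp : p ∈ zeros u₀ := by
      rw [hini] at hw
      exact hw
    -- The initial zero `w` need not be the chosen representative of its class, so `x` is translated
    -- along with it.
    obtain ⟨n, hn, hwn⟩ := exists_add_eq_of_mk_eq (hmk p).symm
    obtain ⟨h1, h2⟩ := hζ p t hp ht
    have h3 : x + n ∈ closedBall p.out (R * l) := by
      rw [mem_closedBall_iff_norm, ← hwn, show x + n - (w + n) = x - w by abel]
      exact hxw
    have h4 := hU.eq_of_zeros hf' hs ht (hout p hp) (hsub _ h1) (hsub _ h3) h2
      ((periodicLift_add (u t) hn x).trans hq)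
    refine ⟨p, hp, ?_⟩
    simp only [h4]
    exact QuotientAddGroup.mk_add_of_mem x hn
  · have h1 := dist_mk_le (ζ p t) p.out
    rw [hmk] at h1
    exact h1.trans (mem_closedBall_iff_norm.1 (hζ p t hp ht).1)
  · obtain ⟨h1, h2⟩ := hζ p t hp ht
    have h3 := hU.hasDegreeAt_of_zero hf' hs hl ht (hout p hp) h1 h2
    rw [hini] at h3
    exact hasTorusDegreeAt_mk h3

/-- At the final time the solution is bounded below away from the initial zeros. -/
theorem half_le_norm {ε T l σ R C : ℝ} {u : ℝ → Torus → Plane}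
    (hf : NondegenerateDatum (periodicLift u₀) α₀ L m r) (hu : IsSolution ε u₀ u) (hT : 0 ≤ T)
    (hs : IsSmallScale ε T l σ R α₀ L m r) (hσ : Real.exp T * l = σ) (hC : 6 ≤ m * C * σ)
    (hC1 : m / 2 * C * l ≤ α₀ / 2) (hC2 : m / 2 * C * l ≤ m / 2 * r) {p : Torus}
    (hp : ∀ q ∈ zeros u₀, C * l ≤ dist p q) : 1 / 2 ≤ ‖u T p‖ := by
  have hU := hu.isPlaneSolution T
  have hini : periodicLift (u 0) = periodicLift u₀ := by rw [hu.initial]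
  have hf' : NondegenerateDatum (periodicLift (u 0)) α₀ L m r := by rwa [hini]
  have hm := hf.m_pos
  obtain ⟨x, rfl⟩ := QuotientAddGroup.mk_surjective p
  -- A smaller initial value would produce a zero of `u₀` at distance less than `C l`.
  have h1 : m / 2 * C * l ≤ ‖periodicLift (u 0) x‖ := by
    by_contra! hlt
    obtain ⟨z, hz, hxz⟩ := hf'.exists_zero_near (hlt.le.trans hC1) (hlt.le.trans hC2)
    rw [hini] at hz
    have h2 := (hp (QuotientAddGroup.mk z) hz).trans (dist_mk_le x z)
    nlinarith
  have h2 : 3 ≤ Real.exp T * ‖periodicLift (u 0) x‖ := by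
    calc (3 : ℝ) ≤ m / 2 * C * (Real.exp T * l) := by rw [hσ]; linarith
      _ = Real.exp T * (m / 2 * C * l) := by ring
      _ ≤ _ := by gcongr
  have h3 := three_quarters_le_norm_odeFlow hT h2
  have h4 := hU.norm_sub_odeFlow_le_quarter hf' hs ⟨hT, le_rfl⟩ x
  have h5 := norm_sub_norm_le (odeFlow T (periodicLift (u 0) x)) (periodicLift (u T) x)
  rw [norm_sub_rev] at h5
  have h6 : u T (QuotientAddGroup.mk x) = periodicLift (u T) x := rfl
  rw [h6]
  linarith

end Datum

theorem exists_nondegenerateDatum {u₀ : Torus → Plane} (hu₀ : ContDiff ℝ 1 (periodicLift u₀))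
    {α₀ : ℝ} (hα₀ : 0 < α₀)
    (hnondeg : ∀ x : Plane, α₀ ≤ ‖periodicLift u₀ x‖ + |(fderiv ℝ (periodicLift u₀) x).det|) :
    ∃ L m r, NondegenerateDatum (periodicLift u₀) α₀ L m r := by
  have hc : Continuous (fderiv ℝ (periodicLift u₀)) := hu₀.continuous_fderiv (by norm_num)
  have hper : ∀ n ∈ intLattice, ∀ x,
      fderiv ℝ (periodicLift u₀) (x + n) = fderiv ℝ (periodicLift u₀) x :=
    fun n hn x => fderiv_periodicLift_add u₀ hn x
  obtain ⟨M, hM⟩ := exists_norm_le_of_periodic hc hper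
  have hM0 : 0 ≤ M := (norm_nonneg _).trans (hM 0)
  obtain ⟨r, hr, hmod⟩ := exists_modulus_of_periodic hc hper
    (κ := α₀ / 2 / (2 * (M + 1)) / 4) (by positivity)
  -- `M + 1` rather than `M`, which may be 0.
  exact ⟨M + 1, α₀ / 2 / (2 * (M + 1)), r, hu₀.differentiable (by norm_num), hα₀, by linarith, hr,
    rfl, fun x => (hM x).trans (by linarith), hmod, hnondeg⟩

/-! ### Choice of the scales -/

/-- This identity dictates the form of the final time: `½ ln ln (1/ε)` compensates the square root
in the length scale. -/
theorem exp_finalTime_mul {C₀ ε : ℝ} (hε : 0 < ε) (h : 0 < Real.log (1 / ε)) :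
    Real.exp (finalTime C₀ ε) * (ε * √(Real.log (1 / ε))) = Real.exp (-C₀) := by
  have h1 : Real.exp (1 / 2 * Real.log (Real.log (1 / ε))) = √(Real.log (1 / ε)) := by
    rw [Real.sqrt_eq_rpow, Real.rpow_def_of_pos h, mul_comm]
  have hs : 0 < √(Real.log (1 / ε)) := Real.sqrt_pos.2 h
  rw [finalTime, sub_eq_add_neg, Real.exp_add, Real.exp_sub, h1, Real.exp_log (by positivity)]
  field_simp

theorem tendsto_log_one_div : Tendsto (fun ε : ℝ => Real.log (1 / ε)) (𝓝[>] 0) atTop := by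
  simp only [one_div]
  exact Real.tendsto_log_atTop.comp tendsto_inv_nhdsGT_zero

theorem tendsto_mul_sqrt_log_one_div :
    Tendsto (fun ε : ℝ => ε * √(Real.log (1 / ε))) (𝓝[>] 0) (𝓝 0) := by
  have hlim : Tendsto (fun ε : ℝ => √ε) (𝓝[>] 0) (𝓝 0) := by
    simpa using (Real.continuous_sqrt.tendsto 0).mono_left nhdsWithin_le_nhds
  refine squeeze_zero' ?_ ?_ hlim
  · filter_upwards [self_mem_nhdsWithin] with ε hε
    exact mul_nonneg (le_of_lt hε) (Real.sqrt_nonneg _)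
  · filter_upwards [self_mem_nhdsWithin] with ε hε
    have hε : 0 < ε := hε
    have h1 : Real.log (1 / ε) ≤ 1 / ε := (Real.log_le_self (by positivity))
    calc ε * √(Real.log (1 / ε)) ≤ ε * √(1 / ε) := by gcongr
      _ = √ε := by
        rw [Real.sqrt_div zero_le_one, Real.sqrt_one]
        have := Real.sqrt_pos.2 hε
        field_simp
        exact (Real.sq_sqrt hε.le).symm

theorem eventually_isSmallScale {α₀ L m r σ C₀ : ℝ} (hα : 0 < α₀) (hm : 0 < m)
    (hr : 0 < r) (hC₀ : 0 < C₀) (hσ : σ = Real.exp (-C₀))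
    (h1 : 3 * L ^ 3 * ((20 * (8 * L / m) ^ 2 + 4) * σ ^ 2) ≤ m / 8) (h2 : 2 * L * σ ≤ 1 / 4) :
    ∀ᶠ ε in 𝓝[>] (0 : ℝ), 0 < finalTime C₀ ε ∧ 0 < ε * √(Real.log (1 / ε)) ∧
      Real.exp (finalTime C₀ ε) * (ε * √(Real.log (1 / ε))) = σ ∧
      IsSmallScale ε (finalTime C₀ ε) (ε * √(Real.log (1 / ε))) σ (8 * L / m) α₀ L m r := by
  have hev : ∀ c : ℝ, ∀ b > 0, ∀ᶠ ε in 𝓝[>] (0 : ℝ), c * (ε * √(Real.log (1 / ε))) ≤ b := by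
    intro c b hb
    have := tendsto_mul_sqrt_log_one_div.const_mul c
    rw [mul_zero] at this
    exact this.eventually (eventually_le_nhds hb)
  have hev2 : ∀ c : ℝ, ∀ b > 0, ∀ᶠ ε in 𝓝[>] (0 : ℝ), c * (ε * √(Real.log (1 / ε))) ^ 2 ≤ b := by
    intro c b hb
    have := (tendsto_mul_sqrt_log_one_div.pow 2).const_mul c
    rw [zero_pow two_ne_zero, mul_zero] at this
    exact this.eventually (eventually_le_nhds hb)
  -- With `x = ln (1/ε)`, the bound `x ≥ 1` gives `0 ≤ ln x ≤ x`, hence `T ≤ x` and `ε² t ≤ l²`; the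
  -- bound `x ≥ 2 C₀ + 1` then makes `T ≥ x / 2 - C₀` positive.
  filter_upwards [self_mem_nhdsWithin, tendsto_log_one_div.eventually_ge_atTop (max 1 (2 * C₀ + 1)),
    hev (4 * (8 * L / m)) (r / 2) (by positivity),
    hev2 (8 * L / r ^ 2 * (4 * (8 * L / m) ^ 2 + 4)) (m / 8) (by positivity),
    hev (4 * L) (α₀ / 2) (by positivity), hev (4 * L) (m / 2 * r) (by positivity)]
    with ε hε hlog e1 e2 e3 e4
  have hε : 0 < ε := hε
  set x := Real.log (1 / ε) with hx
  have hx1 : 1 ≤ x := (le_max_left _ _).trans hlog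
  have hx2 : 2 * C₀ + 1 ≤ x := (le_max_right _ _).trans hlog
  have hxpos : 0 < x := by linarith
  have hlx : Real.log x ≤ x := Real.log_le_self hxpos.le
  have hlx0 : 0 ≤ Real.log x := Real.log_nonneg hx1
  have hTdef : finalTime C₀ ε = x - 1 / 2 * Real.log x - C₀ := rfl
  have hTpos : 0 < finalTime C₀ ε := by rw [hTdef]; linarith
  have hTx : finalTime C₀ ε ≤ x := by rw [hTdef]; linarith
  have hl : 0 < ε * √x := by positivity
  have hexp := exp_finalTime_mul (C₀ := C₀) hε hxpos
  rw [← hx, ← hσ] at hexp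
  refine ⟨hTpos, hl, hexp, hl.le, rfl, fun t ht => ?_, fun t ht => ?_, ?_, ?_, h1, h2, e3, e4⟩
  · rw [mul_pow, Real.sq_sqrt hxpos.le]
    have := ht.2.trans hTx
    gcongr
  · rw [← hexp]
    gcongr
    exact ht.2
  · rwa [← mul_assoc]
  · rwa [← mul_assoc]

theorem eventually_sigma {L m : ℝ} (hm : 0 < m) :
    ∀ᶠ C₀ in atTop, 3 * L ^ 3 * ((20 * (8 * L / m) ^ 2 + 4) * Real.exp (-C₀) ^ 2) ≤ m / 8 ∧
      2 * L * Real.exp (-C₀) ≤ 1 / 4 := by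
  have hexp : Tendsto (fun x : ℝ => Real.exp (-x)) atTop (𝓝 0) := Real.tendsto_exp_neg_atTop_nhds_zero
  have h1 := ((hexp.pow 2).const_mul (20 * (8 * L / m) ^ 2 + 4)).const_mul (3 * L ^ 3)
  have h2 := hexp.const_mul (2 * L)
  rw [zero_pow two_ne_zero, mul_zero, mul_zero] at h1
  rw [mul_zero] at h2
  exact (h1.eventually (eventually_le_nhds (by positivity))).and
    (h2.eventually (eventually_le_nhds (by norm_num)))

/-! ### The main theorem -/

theorem theorem1 (u₀ : Torus → Plane) (hu₀ : ContDiff ℝ 1 (periodicLift u₀))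
    (α₀ : ℝ) (hα₀ : 0 < α₀)
    (hnondeg : ∀ x : Plane, α₀ ≤ ‖periodicLift u₀ x‖ + |(fderiv ℝ (periodicLift u₀) x).det|) :
    (zeros u₀).Finite ∧
    ∃ d : Torus → ℤ,
      (∀ p ∈ zeros u₀, (d p = 1 ∨ d p = -1) ∧ HasTorusDegreeAt u₀ p (d p)) ∧
      ∃ C₀ : ℝ, 0 < C₀ ∧ ∃ C : ℝ, 0 < C ∧ ∃ ε₀ : ℝ, 0 < ε₀ ∧
        ∀ ε : ℝ, 0 < ε → ε < ε₀ → ∀ u : ℝ → Torus → Plane, IsSolution ε u₀ u →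
          (∀ t ∈ Icc 0 (finalTime C₀ ε), (zeros (u t)).encard = (zeros u₀).encard) ∧
          (∃ z : Torus → ℝ → Torus,
            (∀ p ∈ zeros u₀, z p 0 = p ∧ ContinuousOn (z p) (Icc 0 (finalTime C₀ ε))) ∧
            ∀ t ∈ Icc 0 (finalTime C₀ ε),
              BijOn (fun p => z p t) (zeros u₀) (zeros (u t)) ∧
              ∀ p ∈ zeros u₀,
                dist (z p t) p ≤ C * (ε * Real.sqrt (Real.log (1 / ε))) ∧
                HasTorusDegreeAt (u t) (z p t) (d p)) ∧
          ∀ x : Torus,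
            (∀ p ∈ zeros u₀, C * (ε * Real.sqrt (Real.log (1 / ε))) ≤ dist x p) →
              1 / 2 ≤ ‖u (finalTime C₀ ε) x‖ := by
  obtain ⟨L, m, r, hf⟩ := exists_nondegenerateDatum hu₀ hα₀ hnondeg
  have hm := hf.m_pos
  have hL := hf.lip_pos
  have hr := hf.radius_pos
  obtain ⟨C₀, ⟨hσ1, hσ2⟩, hC₀⟩ := ((eventually_sigma (L := L) hm).and (eventually_gt_atTop 0)).exists
  set σ := Real.exp (-C₀) with hσ
  have hσ0 : 0 < σ := Real.exp_pos _
  set R := 8 * L / m with hR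
  have hR0 : 0 < R := by positivity
  -- `R` controls the displacement of the zeros, and `6 / (m σ)` gives `eᵗ |u₀| ≥ 3` at the final
  -- time. Only `ε₀` remains to be chosen, after `C₀` and `C`.
  set C := max R (6 / (m * σ)) with hC
  have hC0 : 0 < C := hR0.trans_le (le_max_left _ _)
  have hevl : ∀ b > 0, ∀ᶠ ε in 𝓝[>] (0 : ℝ), m / 2 * C * (ε * √(Real.log (1 / ε))) ≤ b := by
    intro b hb
    have := tendsto_mul_sqrt_log_one_div.const_mul (m / 2 * C)
    rw [mul_zero] at this
    exact this.eventually (eventually_le_nhds hb)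
  obtain ⟨ε₀, hε₀, hsub⟩ := mem_nhdsGT_iff_exists_Ioo_subset.1
    (((eventually_isSmallScale hα₀ hm hr hC₀ hσ hσ1 hσ2).and
      (hevl (α₀ / 2) (by positivity))).and (hevl (m / 2 * r) (by positivity)))
  refine ⟨finite_zeros hf, jacobianSign u₀, fun p hp => ⟨?_, hasTorusDegreeAt_initial hf hp⟩,
    C₀, hC₀, C, hC0, ε₀, hε₀, fun ε hε hεlt u hu => ?_⟩
  · unfold jacobianSign
    split_ifs <;> simp
  obtain ⟨⟨⟨hT, hl, hexp, hs⟩, hC1⟩, hC2⟩ := hsub ⟨hε, hεlt⟩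
  obtain ⟨z, hz, hzt⟩ := exists_zero_paths hf hu hl hs
  refine ⟨fun t ht => ?_, ⟨z, fun p hp => ⟨(hz p hp).1 ⟨le_rfl, hT.le⟩, (hz p hp).2⟩,
    fun t ht => ⟨(hzt t ht).1, fun p hp => ⟨?_, ((hzt t ht).2 p hp).2⟩⟩⟩, fun x hx => ?_⟩
  · rw [← (hzt t ht).1.image_eq, (hzt t ht).1.injOn.encard_image]
  · refine ((hzt t ht).2 p hp).1.trans ?_
    gcongr
    exact le_max_left _ _
  · refine half_le_norm hf hu hT.le hs hexp ?_ hC1 hC2 hx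
    have h1 : 6 / (m * σ) ≤ C := le_max_right _ _
    rw [div_le_iff₀ (by positivity)] at h1
    linarith
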